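/- For $f\in L^1(\mathbb R)$ let $\hat f(t)=\int_{\mathbb R}e^{\imath tx}f(x)\,dx$. For $\gamma>0$, $\delta>1$ and $L>0$ let $w_{\gamma,\delta}(t)=(1+|t|^2)^{\gamma/2}(\log(e+|t|))^{-\delta/2}$, $t\in\mathbb R$, and let $$\mathscr F^{\mathcal{LS}}_{\gamma,\delta}(L)=\{f:\ f\ge 0,\ \|f\|_1=1 \text{ and } \|w_{\gamma,\delta}\hat f\|_2^2\le L^2\}$$ be the logarithmic Sobolev class of probability densities on $\mathbb R$. Put $\psi_{n,\gamma}=n^{-\gamma/(2\gamma+1)}$ and let $$R_n(\gamma,\delta,L)=\inf_{\hat f_n}\ \sup_{f\in\mathscr F^{\mathcal{LS}}_{\gamma,\delta}(L)}\mathbb E^n_f\big[\|\hat f_n-f\|_2^2\big],$$ where the infimum is over all estimators $\hat f_n$ (measurable real-valued functions $\hat f_n(y_1,\dots,y_n;x)$ of the $n$ observations and of $x\in\mathbb R$) and $\mathbb E^n_f$ is the expectation with respect to the $n$-fold product of the law $P_f$ with density $f$. Then, for all $\gamma>0$ and $L>0$: (1) there is a constant $c>0$, depending only on $\gamma$ and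 $L$, such that $c\,\psi_{n,\gamma}^2\le R_n(\gamma,\delta,L)$ for all $\delta>1$ and all $n\ge 1$; (2) for every $\delta>1$ there is a constant $C>0$, depending only on $\gamma$, $\delta$ and $L$, such that $R_n(\gamma,\delta,L)\le C\,\psi_{n,\gamma}^2(\log n)^{\delta/(2\gamma+1)}$ for all $n\ge 2$. -/

import Mathlib

open MeasureTheory
open scoped ENNReal

namespace LogSobolev

noncomputable section

/-- The Fourier transform `f̂(t) = ∫ e^{itx} f(x) dx` of a real function on the line. -/
def fourierHat (f : ℝ → ℝ) (t : ℝ) : ℂ :=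
  ∫ x : ℝ, Complex.exp (Complex.I * (t : ℂ) * (x : ℂ)) * (f x : ℂ)

/-- The weight `w_{γ,δ}(t) = (1 + |t|²)^{γ/2} (log (e + |t|))^{-δ/2}`. -/
def weight (γ δ t : ℝ) : ℝ :=
  (1 + |t| ^ 2) ^ (γ / 2) * Real.log (Real.exp 1 + |t|) ^ (-δ / 2)

/-- Probability densities with respect to Lebesgue measure on the line. -/
def IsDensity (f : ℝ → ℝ) : Prop :=
  (∀ x, 0 ≤ f x) ∧ Integrable f ∧ ∫ x, f x = 1

/-- The logarithmic Sobolev class of densities with parameters `γ`, `δ` and radius `L`: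
the densities `f` with `‖w_{γ,δ} f̂‖₂² ≤ L²`. -/
def densityClass (γ δ L : ℝ) : Set (ℝ → ℝ) :=
  {f | IsDensity f ∧
    eLpNorm (fun t : ℝ => (weight γ δ t : ℂ) * fourierHat f t) 2 volume ^ 2
      ≤ ENNReal.ofReal (L ^ 2)}

/-- The law `P_f` on the line with Lebesgue density `f`. -/
def law (f : ℝ → ℝ) : Measure ℝ :=
  volume.withDensity fun x => ENNReal.ofReal (f x)

/-- The law of `n` independent observations from `P_f`. -/
def sampleLaw (n : ℕ) (f : ℝ → ℝ) : Measure (Fin n → ℝ) :=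
  Measure.pi fun _ => law f

/-- The mean integrated squared error `E_f^n ‖f̂ₙ - f‖₂²` (possibly infinite) of `est`, where
`est y x` is the value at `x` of the estimate computed from the sample `y`. -/
def risk (n : ℕ) (est : (Fin n → ℝ) → ℝ → ℝ) (f : ℝ → ℝ) : ℝ≥0∞ :=
  ∫⁻ y, eLpNorm (fun x => est y x - f x) 2 volume ^ 2 ∂(sampleLaw n f)

/-- The `L²`-minimax risk over a class `F` of densities: the infimum, over all (jointly
measurable, real-valued) estimators based on `n` observations, of the maximal risk over `F`. -/
def minimaxRisk (n : ℕ) (F : Set (ℝ → ℝ)) : ℝ≥0∞ :=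
  ⨅ (est : (Fin n → ℝ) → ℝ → ℝ) (_ : Measurable (Function.uncurry est)),
    ⨆ f ∈ F, risk n est f

/-- The rate `ψ_{n,γ} = n^{-γ/(2γ+1)}`. -/
def rate (n : ℕ) (γ : ℝ) : ℝ :=
  (n : ℝ) ^ (-γ / (2 * γ + 1))

end

end LogSobolev

/-! Upper bound: a kernel density estimator whose kernel has a Fourier transform equal to 1 near the
origin and with values in [0, 1]. At bandwidth 1/N its integrated variance is at most a constant
times N/n. Its bias lives on frequencies beyond N, where the weight turns the class condition into a
bound of order N^(-2γ) (log(e+N))^δ. Equating the two with N = (n (log n)^δ)^(1/(2γ+1)) gives the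
rate. This is `risk_kernelEstimator_le`, `lintegral_bias_le` and `one_le_weight_sq`.

Lower bound: since log(e+|t|) ≥ 1, the squared weight is at most (1+t²)^γ, so every logarithmic
class contains the ordinary Sobolev class of the same radius; hence a constant free of δ. Inside it,
a flat smooth density is perturbed by ±a φ(mx-k), k < m, with m of order n^(1/(2γ+1)) and a of order
m^(-γ). Switching one sign moves the density by order a²/m = O(1/n) in squared L² distance, so n
observations cannot detect it; the m undecided signs cost a risk of order a², that is,
n^(-2γ/(2γ+1)). This is `lintegral_sobolev_le` (membership), `lintegral_min_ge`
(indistinguishability) and `le_minimaxRisk_of_hypercube` (Assouad). -/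

namespace LogSobolev

/-! ### Plancherel and Sobolev norms for `fourierHat` -/

section Fourier

open Real Complex FourierTransform SchwartzMap

lemma fourierHat_eq_fourier (f : ℝ → ℝ) (t : ℝ) :
    fourierHat f t = 𝓕 (fun x => (f x : ℂ)) (-t / (2 * π)) := by
  rw [fourierHat, Real.fourier_real_eq_integral_exp_smul]
  congr 1
  ext x
  rw [smul_eq_mul]
  congr 2
  have : (π : ℂ) ≠ 0 := by exact_mod_cast Real.pi_ne_zero
  push_cast
  field_simp

/-- Change of variables between the two normalisations of the frequency. -/
lemma lintegral_comp_neg_div_two_pi (g : ℝ → ℝ≥0∞) :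
    ∫⁻ t : ℝ, g (-t / (2 * π)) = ENNReal.ofReal (2 * π) * ∫⁻ s, g s := by
  have h2 : (-(2 * π)⁻¹ : ℝ) ≠ 0 := neg_ne_zero.2 (by positivity)
  have h : Measure.map (fun t : ℝ => -(2 * π)⁻¹ * t) volume
      = ENNReal.ofReal (2 * π) • volume := by
    rw [Real.map_volume_mul_left h2]
    congr 2
    rw [inv_neg, inv_inv, abs_neg, abs_of_pos (by positivity)]
  have he : MeasurableEmbedding (fun t : ℝ => -(2 * π)⁻¹ * t) :=
    (Homeomorph.mulLeft₀ _ h2).measurableEmbedding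
  rw [← smul_eq_mul (ENNReal.ofReal (2 * π)), ← lintegral_smul_measure, ← h, he.lintegral_map]
  congr 1
  ext t
  congr 1
  ring

/-- **Plancherel's theorem** for integrable functions with square integrable Fourier transform. -/
theorem eLpNorm_fourier_eq_of_integrable {u : ℝ → ℂ} (hu : Integrable u)
    (h : MemLp (𝓕 u) 2) : eLpNorm u 2 volume = eLpNorm (𝓕 u) 2 volume := by
  set F : Lp ℂ 2 (volume : Measure ℝ) := h.toLp (𝓕 u) with hF
  -- The L² preimage `v` of the transform is compared with `u`: moving the transform onto test
  -- functions shows that both have the same integrals against every Schwartz function, so they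
  -- agree a.e. and the L² isometry applies.
  set v : Lp ℂ 2 (volume : Measure ℝ) := 𝓕⁻ F with hv
  have hvF : 𝓕 v = F := by rw [hv]; exact FourierTransform.fourier_fourierInv_eq F
  have hint : ∀ g : 𝓢(ℝ, ℂ), ∫ x, g x • v x = ∫ x, g x • u x := by
    intro g
    obtain ⟨g', rfl⟩ : ∃ g' : 𝓢(ℝ, ℂ), 𝓕 g' = g := ⟨𝓕⁻ g, FourierTransform.fourier_fourierInv_eq g⟩
    have h1 := congrArg (fun T : 𝓢'(ℝ, ℂ) => T g') (Lp.fourier_toTemperedDistribution_eq v)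
    simp only [hvF, TemperedDistribution.fourier_apply, Lp.toTemperedDistribution_apply] at h1
    rw [h1]
    have h2 : ∫ x, g' x • F x = ∫ x, g' x • 𝓕 u x := by
      apply integral_congr_ae
      filter_upwards [h.coeFn_toLp] with x hx
      rw [hF, hx]
    rw [h2]
    have h3 := VectorFourier.integral_fourierIntegral_smul_eq_flip (L := innerₗ ℝ) (μ := volume) (ν := volume)
      Real.continuous_fourierChar continuous_inner g'.integrable hu
    rw [flip_innerₗ] at h3
    rw [SchwartzMap.fourier_coe]
    exact h3.symm
  have hae : v =ᵐ[volume] u := by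
    apply ae_eq_of_integral_contDiff_smul_eq ((Lp.memLp v).locallyIntegrable (by norm_num))
      hu.locallyIntegrable
    intro g hg hgc
    have hg₁ : HasCompactSupport (Complex.ofRealCLM ∘ g) := hgc.comp_left rfl
    have hg₂ : ContDiff ℝ (⊤ : ℕ∞) (Complex.ofRealCLM ∘ g) := Complex.ofRealCLM.contDiff.comp hg
    simpa using hint (hg₁.toSchwartzMap hg₂)
  rw [← eLpNorm_congr_ae hae, ← eLpNorm_congr_ae h.coeFn_toLp, ← hF, ← Lp.enorm_def, ← Lp.enorm_def,
    ← hvF]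
  simp only [← ofReal_norm, Lp.norm_fourier_eq]

lemma eLpNorm_two_sq {α E : Type*} [MeasurableSpace α] [NormedAddCommGroup E] {μ : Measure α}
    (f : α → E) : eLpNorm f 2 μ ^ 2 = ∫⁻ x, ‖f x‖ₑ ^ 2 ∂μ := by
  have := eLpNorm_nnreal_pow_eq_lintegral (μ := μ) (f := f) (p := 2) (by norm_num)
  simpa using this

lemma aestronglyMeasurable_fourier {u : ℝ → ℂ} (hu : Integrable u) :
    AEStronglyMeasurable (𝓕 u) volume :=
  (VectorFourier.fourierIntegral_continuous Real.continuous_fourierChar (by fun_prop) hu).aestronglyMeasurable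

lemma integrable_coe {f : ℝ → ℝ} (hf : Integrable f) : Integrable fun x => (f x : ℂ) := hf.ofReal

lemma tsupport_iteratedDeriv_subset (f : ℝ → ℝ) (k : ℕ) :
    tsupport (iteratedDeriv k f) ⊆ tsupport f := by
  induction k with
  | zero => simp
  | succ k ih =>
    rw [iteratedDeriv_succ]
    exact fun x hx => ih (tsupport_deriv_subset hx)

lemma hasCompactSupport_iteratedDeriv {f : ℝ → ℝ} (hc : HasCompactSupport f) (k : ℕ) :
    HasCompactSupport (iteratedDeriv k f) :=
  hc.of_isClosed_subset (isClosed_tsupport _) (tsupport_iteratedDeriv_subset f k)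

lemma contDiff_iteratedDeriv {f : ℝ → ℝ} (hf : ContDiff ℝ (⊤ : ℕ∞) f) (k : ℕ) :
    ContDiff ℝ (⊤ : ℕ∞) (iteratedDeriv k f) := by
  rw [iteratedDeriv_eq_iterate]
  exact hf.iterate_deriv k

lemma integrable_sq_of_contDiff {f : ℝ → ℝ} (hf : ContDiff ℝ (⊤ : ℕ∞) f)
    (hc : HasCompactSupport f) : Integrable fun x => f x ^ 2 := by
  have h1 : HasCompactSupport fun x => f x ^ 2 := by
    simp only [pow_two]
    exact hc.mul_right
  exact (hf.continuous.pow 2).integrable_of_hasCompactSupport h1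

lemma continuous_fourierHat {f : ℝ → ℝ} (hf : Integrable f) : Continuous (fourierHat f) := by
  have h : Continuous (𝓕 (fun x => (f x : ℂ))) :=
    VectorFourier.fourierIntegral_continuous Real.continuous_fourierChar (by fun_prop) (integrable_coe hf)
  have : fourierHat f = fun t => 𝓕 (fun x => (f x : ℂ)) (-t / (2 * π)) :=
    funext (fourierHat_eq_fourier f)
  rw [this]
  exact h.comp (by fun_prop)

/-- Plancherel's identity for `fourierHat`. -/
theorem lintegral_fourierHat_sq {f : ℝ → ℝ} (hf : Integrable f)
    (h : ∫⁻ t, ‖fourierHat f t‖ₑ ^ 2 ≠ ∞) :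
    ∫⁻ t, ‖fourierHat f t‖ₑ ^ 2 = ENNReal.ofReal (2 * π) * ∫⁻ x, ‖f x‖ₑ ^ 2 := by
  have h1 : ∫⁻ t, ‖fourierHat f t‖ₑ ^ 2
      = ENNReal.ofReal (2 * π) * ∫⁻ s, ‖𝓕 (fun x => (f x : ℂ)) s‖ₑ ^ 2 := by
    rw [← lintegral_comp_neg_div_two_pi]
    simp_rw [fourierHat_eq_fourier]
  rw [h1] at h ⊢
  have h2 : ∫⁻ s, ‖𝓕 (fun x => (f x : ℂ)) s‖ₑ ^ 2 ≠ ∞ := by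
    intro h3
    rw [h3, ENNReal.mul_top] at h
    · exact h rfl
    · simp [Real.pi_pos]
  have hm : MemLp (𝓕 (fun x => (f x : ℂ))) 2 := by
    refine ⟨aestronglyMeasurable_fourier (integrable_coe hf), ?_⟩
    rw [← eLpNorm_two_sq] at h2
    rw [lt_top_iff_ne_top]
    intro h3
    simp [h3] at h2
  congr 1
  rw [← eLpNorm_two_sq, ← eLpNorm_fourier_eq_of_integrable (integrable_coe hf) hm, eLpNorm_two_sq]
  congr 1
  ext x
  rw [← ofReal_norm, ← ofReal_norm, Complex.norm_real]

lemma integrable_exp_mul {f : ℝ → ℝ} (hf : Integrable f) (t : ℝ) :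
    Integrable fun x : ℝ => Complex.exp (Complex.I * (t : ℂ) * (x : ℂ)) * (f x : ℂ) := by
  refine (integrable_coe hf).bdd_mul (c := 1) (by fun_prop) (ae_of_all _ fun x => ?_)
  have : Complex.I * (t : ℂ) * (x : ℂ) = ((t * x : ℝ) : ℂ) * Complex.I := by push_cast; ring
  rw [this, Complex.norm_exp_ofReal_mul_I]

lemma fourierHat_add {f g : ℝ → ℝ} (hf : Integrable f) (hg : Integrable g) (t : ℝ) :
    fourierHat (fun x => f x + g x) t = fourierHat f t + fourierHat g t := by
  simp only [fourierHat]
  rw [← integral_add (integrable_exp_mul hf t) (integrable_exp_mul hg t)]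
  congr 1
  ext x
  push_cast
  ring

lemma fourierHat_sub {f g : ℝ → ℝ} (hf : Integrable f) (hg : Integrable g) (t : ℝ) :
    fourierHat (fun x => f x - g x) t = fourierHat f t - fourierHat g t := by
  simp only [fourierHat]
  rw [← integral_sub (integrable_exp_mul hf t) (integrable_exp_mul hg t)]
  congr 1
  ext x
  push_cast
  ring

lemma fourierHat_iteratedDeriv {f : ℝ → ℝ} (hf : ContDiff ℝ (⊤ : ℕ∞) f) (hc : HasCompactSupport f)
    (k : ℕ) (t : ℝ) :
    fourierHat (iteratedDeriv k f) t = (-(Complex.I * t)) ^ k * fourierHat f t := by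
  have hF : ContDiff ℝ (⊤ : ℕ∞) (fun x => (f x : ℂ)) := Complex.ofRealCLM.contDiff.comp hf
  have hd : ∀ n : ℕ, iteratedDeriv n (fun x => (f x : ℂ)) = fun x => ((iteratedDeriv n f x : ℝ) : ℂ) := by
    intro n
    induction n with
    | zero => simp
    | succ n ih =>
      rw [iteratedDeriv_succ, ih, iteratedDeriv_succ]
      ext x
      have hdx : DifferentiableAt ℝ (iteratedDeriv n f) x :=
        (hf.differentiable_iteratedDeriv n (by exact_mod_cast WithTop.coe_lt_top _)) x
      exact hdx.hasDerivAt.ofReal_comp.deriv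
  have hint : ∀ n : ℕ, (n : ℕ∞) ≤ ⊤ → Integrable (iteratedDeriv n (fun x => (f x : ℂ))) := by
    intro n _
    rw [hd]
    have h1 : Integrable (iteratedDeriv n f) :=
      (hf.continuous_iteratedDeriv n (by exact_mod_cast le_top)).integrable_of_hasCompactSupport
        (hasCompactSupport_iteratedDeriv hc n)
    exact h1.ofReal
  rw [fourierHat_eq_fourier, fourierHat_eq_fourier, ← hd,
    Real.fourier_iteratedDeriv hF hint le_top]
  change _ * _ = _
  congr 2
  have : (π : ℂ) ≠ 0 := by exact_mod_cast Real.pi_ne_zero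
  push_cast
  field_simp

lemma lintegral_fourierHat_sq_of_smooth {f : ℝ → ℝ} (hf : ContDiff ℝ (⊤ : ℕ∞) f)
    (hc : HasCompactSupport f) :
    ∫⁻ t, ‖fourierHat f t‖ₑ ^ 2 = ENNReal.ofReal (2 * π * ∫ x, f x ^ 2) := by
  have hi : Integrable f := hf.continuous.integrable_of_hasCompactSupport hc
  have hF : ContDiff ℝ (⊤ : ℕ∞) (Complex.ofRealCLM ∘ f) := Complex.ofRealCLM.contDiff.comp hf
  have hcF : HasCompactSupport (Complex.ofRealCLM ∘ f) := hc.comp_left rfl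
  have hS : MemLp (𝓕 (fun x => (f x : ℂ))) 2 volume := by
    have h1 := (𝓕 (hcF.toSchwartzMap hF)).memLp 2 volume
    rw [SchwartzMap.fourier_coe] at h1
    exact h1
  have hne : ∫⁻ t, ‖fourierHat f t‖ₑ ^ 2 ≠ ∞ := by
    have h1 : ∫⁻ t, ‖fourierHat f t‖ₑ ^ 2
        = ENNReal.ofReal (2 * π) * ∫⁻ s, ‖𝓕 (fun x => (f x : ℂ)) s‖ₑ ^ 2 := by
      rw [← lintegral_comp_neg_div_two_pi]
      simp_rw [fourierHat_eq_fourier]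
    rw [h1, ← eLpNorm_two_sq]
    exact ENNReal.mul_ne_top ENNReal.ofReal_ne_top (ENNReal.pow_ne_top hS.2.ne)
  rw [lintegral_fourierHat_sq hi hne, ENNReal.ofReal_mul (p := 2 * π) (by positivity)]
  congr 1
  rw [ofReal_integral_eq_lintegral_ofReal (integrable_sq_of_contDiff hf hc) (ae_of_all _ fun x => sq_nonneg _)]
  congr 1
  ext x
  rw [← ofReal_norm, ← ENNReal.ofReal_pow (norm_nonneg _), Real.norm_eq_abs, sq_abs]

/-- Trades the fractional order γ for an integer one, so that Sobolev norms can be bounded through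
actual derivatives. -/
lemma rpow_le_one_add_pow {x γ : ℝ} (hx : 0 ≤ x) (hγ : 0 < γ) {k : ℕ} (hk : γ ≤ k) :
    x ^ γ ≤ 1 + x ^ k := by
  rcases le_total x 1 with h | h
  · have := Real.rpow_le_one hx h hγ.le
    have := pow_nonneg hx k
    linarith
  · have := Real.rpow_le_rpow_of_exponent_le h hk
    rw [Real.rpow_natCast] at this
    linarith

/-- The constant in the bound of a Sobolev norm by a derivative of integer order `k`. -/
noncomputable def sobolevConst (k : ℕ) : ℝ := 2 * π * (1 + 2 ^ k)

lemma sobolevConst_pos (k : ℕ) : 0 < sobolevConst k := by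
  unfold sobolevConst; positivity

/-- At scale `h ≤ 1`, the Sobolev norm of order `γ` of a test function is controlled by the `L²`
norms of the function and of its derivative of integer order `k ≥ γ`. -/
theorem lintegral_sobolev_le {f : ℝ → ℝ} (hf : ContDiff ℝ (⊤ : ℕ∞) f) (hc : HasCompactSupport f)
    {γ h : ℝ} (hγ : 0 < γ) {k : ℕ} (hk : γ ≤ k) (hh : 0 < h) (hh1 : h ≤ 1) :
    ∫⁻ t, ENNReal.ofReal ((1 + t ^ 2) ^ γ) * ‖fourierHat f t‖ₑ ^ 2
      ≤ ENNReal.ofReal (h ^ (-(2 * γ)) * (sobolevConst k *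
        ((∫ x, f x ^ 2) + h ^ (2 * k) * ∫ x, iteratedDeriv k f x ^ 2))) := by
  have hi : Integrable f := hf.continuous.integrable_of_hasCompactSupport hc
  have hfk := contDiff_iteratedDeriv hf k
  have hck := hasCompactSupport_iteratedDeriv hc k
  -- Pulling out h^(-2γ) before passing to the integer order k leaves the rescaled frequency ht. For
  -- a function oscillating at scale h the cost is then h^(-2γ) rather than h^(-2k).
  have hpt : ∀ t : ℝ, (1 + t ^ 2) ^ γ ≤
      h ^ (-(2 * γ)) * (1 + 2 ^ k) * (1 + h ^ (2 * k) * (t ^ 2) ^ k) := by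
    intro t
    have h1 : (1 + t ^ 2) ^ γ = h ^ (-(2 * γ)) * (h ^ 2 * (1 + t ^ 2)) ^ γ := by
      rw [Real.mul_rpow (by positivity) (by positivity), ← mul_assoc, ← Real.rpow_natCast h 2,
        ← Real.rpow_mul hh.le, ← Real.rpow_add hh]
      norm_num
    have h2 : (h ^ 2 * (1 + t ^ 2)) ^ γ ≤ 1 + (h ^ 2 * (1 + t ^ 2)) ^ k :=
      rpow_le_one_add_pow (by positivity) hγ hk
    have h3 : (h ^ 2 * (1 + t ^ 2)) ^ k ≤ 2 ^ k * (1 + h ^ (2 * k) * (t ^ 2) ^ k) := by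
      have hx : h ^ 2 * (1 + t ^ 2) ≤ 2 * max 1 (h ^ 2 * t ^ 2) := by
        have h4 : h ^ 2 ≤ 1 := pow_le_one₀ hh.le hh1
        nlinarith [le_max_left 1 (h ^ 2 * t ^ 2), le_max_right 1 (h ^ 2 * t ^ 2)]
      calc (h ^ 2 * (1 + t ^ 2)) ^ k ≤ (2 * max 1 (h ^ 2 * t ^ 2)) ^ k :=
            pow_le_pow_left₀ (by positivity) hx k
        _ = 2 ^ k * (max 1 (h ^ 2 * t ^ 2)) ^ k := mul_pow _ _ _
        _ ≤ _ := by
          gcongr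
          have h5 : (h ^ 2 * t ^ 2) ^ k = h ^ (2 * k) * (t ^ 2) ^ k := by
            rw [mul_pow, ← pow_mul]
          have h6 : 0 ≤ h ^ (2 * k) * (t ^ 2) ^ k := by positivity
          rcases max_cases 1 (h ^ 2 * t ^ 2) with ⟨h7, -⟩ | ⟨h7, -⟩
          · rw [h7]; simpa using h6
          · rw [h7, h5]; linarith
    rw [h1, mul_assoc]
    gcongr
    have h8 : 0 ≤ h ^ (2 * k) * (t ^ 2) ^ k := by positivity
    linarith
  have hk2 : ∀ t : ℝ, ‖fourierHat (iteratedDeriv k f) t‖ₑ ^ 2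
      = ENNReal.ofReal ((t ^ 2) ^ k) * ‖fourierHat f t‖ₑ ^ 2 := by
    intro t
    rw [fourierHat_iteratedDeriv hf hc, enorm_mul, mul_pow]
    congr 1
    rw [← ofReal_norm, ← ENNReal.ofReal_pow (norm_nonneg _), norm_pow, norm_neg, norm_mul,
      Complex.norm_I, one_mul, Complex.norm_real, Real.norm_eq_abs, ← sq_abs t, ← pow_mul,
      ← pow_mul, mul_comm]
  have hm : Measurable fun t => ‖fourierHat f t‖ₑ ^ 2 :=
    (continuous_fourierHat hi).measurable.enorm.pow_const 2
  have hA : 0 ≤ ∫ x, f x ^ 2 := integral_nonneg fun x => sq_nonneg _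
  have hB : 0 ≤ ∫ x, iteratedDeriv k f x ^ 2 := integral_nonneg fun x => sq_nonneg _
  have hD : 0 ≤ h ^ (-(2 * γ)) * (1 + 2 ^ k) := by positivity
  calc ∫⁻ t, ENNReal.ofReal ((1 + t ^ 2) ^ γ) * ‖fourierHat f t‖ₑ ^ 2
      ≤ ∫⁻ t, ENNReal.ofReal (h ^ (-(2 * γ)) * (1 + 2 ^ k)) * (‖fourierHat f t‖ₑ ^ 2
          + ENNReal.ofReal (h ^ (2 * k)) * ‖fourierHat (iteratedDeriv k f) t‖ₑ ^ 2) := by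
        refine lintegral_mono fun t => ?_
        rw [hk2]
        calc _ ≤ ENNReal.ofReal (h ^ (-(2 * γ)) * (1 + 2 ^ k) * (1 + h ^ (2 * k) * (t ^ 2) ^ k))
              * ‖fourierHat f t‖ₑ ^ 2 := by gcongr; exact hpt t
          _ = _ := by
            rw [ENNReal.ofReal_mul hD, ENNReal.ofReal_add zero_le_one (by positivity),
              ENNReal.ofReal_mul (p := h ^ (2 * k)) (by positivity), ENNReal.ofReal_one]
            generalize ENNReal.ofReal ((t ^ 2) ^ k) = a
            ring
    _ = ENNReal.ofReal (h ^ (-(2 * γ)) * (1 + 2 ^ k)) * (ENNReal.ofReal (2 * π * ∫ x, f x ^ 2)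
          + ENNReal.ofReal (h ^ (2 * k)) *
            ENNReal.ofReal (2 * π * ∫ x, iteratedDeriv k f x ^ 2)) := by
        rw [lintegral_const_mul' _ _ ENNReal.ofReal_ne_top, lintegral_add_left hm,
          lintegral_const_mul' _ _ ENNReal.ofReal_ne_top, lintegral_fourierHat_sq_of_smooth hf hc,
          lintegral_fourierHat_sq_of_smooth hfk hck]
    _ = _ := by
        rw [← ENNReal.ofReal_mul (by positivity),
          ← ENNReal.ofReal_add (by positivity) (by positivity), ← ENNReal.ofReal_mul hD,
          sobolevConst]
        congr 1
        ring

end Fourier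

/-! ### The smoothing kernel -/

section Kernel

open Real Complex FourierTransform SchwartzMap

/-- The Fourier transform of a real even function is real. -/
lemma fourier_im_eq_zero {g : ℝ → ℝ} (hg : ∀ x, g (-x) = g x) (x : ℝ) :
    (𝓕 (fun y => (g y : ℂ)) x).im = 0 := by
  have h1 : 𝓕⁻ (fun y => (g y : ℂ)) x = 𝓕 (fun y => (g y : ℂ)) x := by
    rw [Real.fourierInv_eq_fourier_comp_neg]
    simp only [hg]
  rw [← Complex.conj_eq_iff_im]
  conv_rhs => rw [← h1, Real.fourierInv_eq_fourier_neg]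
  rw [Real.fourier_real_eq_integral_exp_smul, Real.fourier_real_eq_integral_exp_smul,
    ← integral_conj]
  congr 1
  ext y
  simp only [smul_eq_mul, map_mul, Complex.conj_ofReal, ← Complex.exp_conj, Complex.conj_I]
  congr 2
  push_cast
  ring

/-- A smoothing kernel of infinite order. -/
theorem exists_kernel : ∃ K : ℝ → ℝ, Continuous K ∧ Integrable K ∧ Integrable (fun x => K x ^ 2) ∧
    (∃ B, ∀ x, |K x| ≤ B) ∧
    ∀ t, ‖fourierHat K t - 1‖ ≤ 1 ∧ (|t| ≤ 1 → fourierHat K t = 1) := by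
  let b : ContDiffBump (0 : ℝ) := ⟨1, 2, one_pos, one_lt_two⟩
  have hF : ContDiff ℝ (⊤ : ℕ∞) (Complex.ofRealCLM ∘ b) :=
    Complex.ofRealCLM.contDiff.comp b.contDiff
  have hcF : HasCompactSupport (Complex.ofRealCLM ∘ b) := b.hasCompactSupport.comp_left rfl
  let χ : 𝓢(ℝ, ℂ) := hcF.toSchwartzMap hF
  have hχ : ∀ x, χ x = (b x : ℂ) := fun x => rfl
  have hχ' : (χ : ℝ → ℂ) = fun x => (b x : ℂ) := rfl
  let κ : 𝓢(ℝ, ℂ) := 𝓕 χ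
  have hκ : (κ : ℝ → ℂ) = 𝓕 (fun x => (b x : ℂ)) := by
    rw [← hχ']
    exact SchwartzMap.fourier_coe χ
  -- The bump is even, so its forward and inverse transforms coincide, and transforming the kernel
  -- gives back the bump. Evenness also makes the kernel real.
  have hκi : 𝓕⁻ χ = κ := by
    ext x
    rw [hκ, ← hχ', SchwartzMap.fourierInv_coe, Real.fourierInv_eq_fourier_comp_neg]
    simp only [hχ, b.neg]
    rfl
  have hκκ : 𝓕 κ = χ := by rw [← hκi]; exact FourierTransform.fourier_fourierInv_eq χ
  have hre : ∀ x, (((κ x).re : ℝ) : ℂ) = κ x := by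
    intro x
    apply Complex.ext
    · simp
    · rw [hκ]
      simpa using (fourier_im_eq_zero (g := b) b.neg x).symm
  have hhat : ∀ t, fourierHat (fun x => (κ x).re) t = (b (-t / (2 * π)) : ℂ) := by
    intro t
    rw [fourierHat_eq_fourier]
    simp only [hre]
    rw [← hχ, ← SchwartzMap.fourier_coe κ, hκκ]
  refine ⟨fun x => (κ x).re, Complex.continuous_re.comp κ.continuous, κ.integrable.re, ?_, ?_, ?_⟩
  · have h1 : MemLp (fun x => (κ x).re) 2 volume := (κ.memLp 2 volume).re
    exact h1.integrable_sq
  · obtain ⟨B, hB⟩ := κ.decay 0 0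
    refine ⟨B, fun x => (Complex.abs_re_le_norm _).trans ?_⟩
    simpa using hB.2 x
  · intro t
    rw [hhat]
    constructor
    · rw [← Complex.ofReal_one, ← Complex.ofReal_sub, Complex.norm_real, Real.norm_eq_abs, abs_le]
      constructor <;> linarith [b.nonneg (x := -t / (2 * π)), b.le_one (x := -t / (2 * π))]
    · intro ht
      rw [b.one_of_mem_closedBall, Complex.ofReal_one]
      rw [Metric.mem_closedBall, dist_zero_right, Real.norm_eq_abs, abs_div, abs_neg,
        abs_of_pos (by positivity : 0 < 2 * π)]
      change |t| / (2 * π) ≤ 1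
      rw [div_le_one (by positivity)]
      linarith [Real.pi_gt_three]

lemma fourierHat_scale (K : ℝ → ℝ) {N : ℝ} (hN : 0 < N) (t : ℝ) :
    fourierHat (fun x => N * K (N * x)) t = fourierHat K (t / N) := by
  have h := Measure.integral_comp_mul_left
    (fun x : ℝ => Complex.exp (Complex.I * ((t / N : ℝ) : ℂ) * (x : ℂ)) * (K x : ℂ)) N
  unfold fourierHat
  have hN' : (N : ℂ) ≠ 0 := by exact_mod_cast hN.ne'
  calc _ = ∫ x : ℝ, (N : ℂ) * (Complex.exp (Complex.I * ((t / N : ℝ) : ℂ) * ((N * x : ℝ) : ℂ))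
        * (K (N * x) : ℂ)) := by
        congr 1
        ext x
        push_cast
        rw [show Complex.I * (t / N) * (N * x) = Complex.I * t * x by field_simp]
        ring
    _ = _ := by
        rw [integral_const_mul, h, abs_of_pos (inv_pos.2 hN), Complex.real_smul, ← mul_assoc]
        push_cast
        rw [mul_inv_cancel₀ hN', one_mul]

end Kernel

/-! ### Bias and variance of kernel estimators -/

section Risk

open ProbabilityTheory

lemma aemeasurable_density {f : ℝ → ℝ} (hf : IsDensity f) :
    AEMeasurable (fun x => ENNReal.ofReal (f x)) volume :=
  hf.2.1.aestronglyMeasurable.aemeasurable.ennreal_ofReal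

lemma isProbabilityMeasure_law {f : ℝ → ℝ} (hf : IsDensity f) : IsProbabilityMeasure (law f) := by
  constructor
  rw [law, withDensity_apply _ MeasurableSet.univ, Measure.restrict_univ,
    ← ofReal_integral_eq_lintegral_ofReal hf.2.1 (ae_of_all _ hf.1), hf.2.2, ENNReal.ofReal_one]

lemma integral_law {f : ℝ → ℝ} (hf : IsDensity f) (g : ℝ → ℝ) :
    ∫ x, g x ∂(law f) = ∫ x, f x * g x := by
  rw [law, integral_withDensity_eq_integral_toReal_smul₀ (aemeasurable_density hf)
    (ae_of_all _ fun x => ENNReal.ofReal_lt_top)]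
  simp_rw [ENNReal.toReal_ofReal (hf.1 _), smul_eq_mul]

/-- The kernel density estimator with kernel `k`. -/
noncomputable def kernelEstimator (n : ℕ) (k : ℝ → ℝ) (y : Fin n → ℝ) (x : ℝ) : ℝ :=
  ∑ i, k (x - y i) / n

lemma measurable_kernelEstimator (n : ℕ) {k : ℝ → ℝ} (hk : Continuous k) :
    Measurable (Function.uncurry (kernelEstimator n k)) := by
  unfold kernelEstimator Function.uncurry
  have hc : Continuous fun p : (Fin n → ℝ) × ℝ => ∑ i, k (p.2 - p.1 i) / n := by fun_prop
  exact hc.measurable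

/-- For fixed x the estimator is a sum of n independent copies of k(x-Y)/n, so its variance is n
times a single variance, which is at most the second moment. -/
lemma lintegral_variance_le {n : ℕ} (hn : 1 ≤ n) {k : ℝ → ℝ} (hk : Continuous k)
    (hb : ∃ B, ∀ x, |k x| ≤ B) {f : ℝ → ℝ} (hf : IsDensity f) (x : ℝ) :
    ∫⁻ y, ‖kernelEstimator n k y x - ∫ z, k (x - z) ∂(law f)‖ₑ ^ 2 ∂(sampleLaw n f)
      ≤ ∫⁻ z, ENNReal.ofReal (k (x - z) ^ 2 / n) ∂(law f) := by
  have := isProbabilityMeasure_law hf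
  obtain ⟨B, hB⟩ := hb
  have hn0 : (n : ℝ) ≠ 0 := by positivity
  have hkm : Continuous fun z => k (x - z) / n := by fun_prop
  have hX : MemLp (fun z => k (x - z) / n) 2 (law f) := by
    refine MemLp.of_bound hkm.aestronglyMeasurable (B / n) (ae_of_all _ fun z => ?_)
    rw [Real.norm_eq_abs, abs_div, Nat.abs_cast]
    gcongr
    exact hB _
  have hsum : ∀ y : Fin n → ℝ, kernelEstimator n k y x
      = (∑ i : Fin n, fun y : Fin n → ℝ => k (x - y i) / n) y := by
    intro y
    simp [kernelEstimator]
  have hXi : ∀ i : Fin n, MemLp (fun y : Fin n → ℝ => k (x - y i) / n) 2 (sampleLaw n f) :=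
    fun i => hX.comp_measurePreserving (measurePreserving_eval (fun _ : Fin n => law f) i)
  have hS : MemLp (∑ i : Fin n, fun y : Fin n → ℝ => k (x - y i) / n) 2 (sampleLaw n f) :=
    memLp_finsetSum' _ fun i _ => hXi i
  have : IsProbabilityMeasure (sampleLaw n f) := by unfold sampleLaw; infer_instance
  have hmean : ∫ y, (∑ i : Fin n, fun y : Fin n → ℝ => k (x - y i) / n) y ∂(sampleLaw n f)
      = ∫ z, k (x - z) ∂(law f) := by
    simp only [Finset.sum_apply]
    rw [integral_finsetSum _ fun i _ => (hXi i).integrable (by norm_num)]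
    have h1 : ∀ i : Fin n, ∫ y : Fin n → ℝ, k (x - y i) / n ∂(sampleLaw n f)
        = ∫ z, k (x - z) / n ∂(law f) := fun i =>
      integral_comp_eval (μ := fun _ : Fin n => law f) (f := fun z => k (x - z) / n)
        hkm.aestronglyMeasurable
    simp only [h1, integral_div]
    simp
    field_simp
  have hvar : Var[∑ i : Fin n, fun y : Fin n → ℝ => k (x - y i) / n; sampleLaw n f]
      ≤ ∫ z, k (x - z) ^ 2 / n ∂(law f) := by
    rw [sampleLaw, variance_sum_pi (X := fun _ z => k (x - z) / n) fun _ => hX]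
    rw [Finset.sum_const, Finset.card_univ, Fintype.card_fin, nsmul_eq_mul]
    calc _ ≤ (n : ℝ) * ∫ z, ((fun z => k (x - z) / n) ^ 2) z ∂(law f) := by
          gcongr
          exact variance_le_expectation_sq hX.aestronglyMeasurable
      _ = _ := by
          rw [← integral_const_mul]
          congr 1
          ext z
          simp only [Pi.pow_apply]
          field_simp
  calc _ = evariance (∑ i : Fin n, fun y : Fin n → ℝ => k (x - y i) / n) (sampleLaw n f) := by
        rw [evariance, hmean]
        simp_rw [hsum]
    _ = ENNReal.ofReal (Var[∑ i : Fin n, fun y : Fin n → ℝ => k (x - y i) / n; sampleLaw n f]) :=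
        (ofReal_variance hS).symm
    _ ≤ ENNReal.ofReal (∫ z, k (x - z) ^ 2 / n ∂(law f)) := ENNReal.ofReal_le_ofReal hvar
    _ = _ := by
        refine ofReal_integral_eq_lintegral_ofReal ?_ (ae_of_all _ fun z => by positivity)
        refine Integrable.of_bound (C := B ^ 2 / n) ?_ (ae_of_all _ fun z => ?_)
        · exact Continuous.aestronglyMeasurable (by fun_prop)
        · rw [Real.norm_eq_abs, abs_div, Nat.abs_cast, abs_pow]
          gcongr
          exact hB _

lemma enorm_add_sq_le (a b : ℝ) : ‖a + b‖ₑ ^ 2 ≤ 2 * ‖a‖ₑ ^ 2 + 2 * ‖b‖ₑ ^ 2 := by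
  have h : ∀ z : ℝ, ‖z‖ₑ ^ 2 = ENNReal.ofReal (z ^ 2) := fun z => by
    rw [← ofReal_norm, ← ENNReal.ofReal_pow (norm_nonneg _), Real.norm_eq_abs, sq_abs]
  rw [h, h, h, ← ENNReal.ofReal_ofNat 2, ← ENNReal.ofReal_mul (by norm_num),
    ← ENNReal.ofReal_mul (by norm_num), ← ENNReal.ofReal_add (by positivity) (by positivity)]
  exact ENNReal.ofReal_le_ofReal (by nlinarith [sq_nonneg (a - b)])

lemma measurable_smoothed {k : ℝ → ℝ} (hk : Continuous k) {f : ℝ → ℝ} (hf : IsDensity f) :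
    Measurable fun x => ∫ z, k (x - z) ∂(law f) := by
  have := isProbabilityMeasure_law hf
  have h1 : StronglyMeasurable (Function.uncurry fun x z : ℝ => k (x - z)) :=
    Continuous.stronglyMeasurable (by unfold Function.uncurry; fun_prop)
  exact h1.integral_prod_right.measurable

lemma measurable_deviation {n : ℕ} {k : ℝ → ℝ} (hk : Continuous k) {f : ℝ → ℝ} (hf : IsDensity f) :
    Measurable fun p : (Fin n → ℝ) × ℝ =>
      ‖kernelEstimator n k p.1 p.2 - ∫ z, k (p.2 - z) ∂(law f)‖ₑ ^ 2 :=
  ((measurable_kernelEstimator n hk).sub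
    ((measurable_smoothed hk hf).comp measurable_snd)).enorm.pow_const 2

/-- By Tonelli and translation invariance the integral of k(x-z)² over x does not depend on z, and
the law of z integrates to 1. -/
lemma lintegral_lintegral_variance_le {n : ℕ} (hn : 1 ≤ n) {k : ℝ → ℝ} (hk : Continuous k)
    (hk2 : Integrable fun x => k x ^ 2) (hb : ∃ B, ∀ x, |k x| ≤ B) {f : ℝ → ℝ} (hf : IsDensity f) :
    ∫⁻ y, ∫⁻ x, ‖kernelEstimator n k y x - ∫ z, k (x - z) ∂(law f)‖ₑ ^ 2 ∂volume ∂(sampleLaw n f)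
      ≤ ENNReal.ofReal ((∫ x, k x ^ 2) / n) := by
  have := isProbabilityMeasure_law hf
  have : IsProbabilityMeasure (sampleLaw n f) := by unfold sampleLaw; infer_instance
  have hsw : ∫⁻ x, ∫⁻ z, ENNReal.ofReal (k (x - z) ^ 2 / n) ∂(law f)
      = ∫⁻ z, ∫⁻ x, ENNReal.ofReal (k (x - z) ^ 2 / n) ∂volume ∂(law f) := by
    have hc : Continuous (Function.uncurry fun x z : ℝ => ENNReal.ofReal (k (x - z) ^ 2 / n)) := by
      unfold Function.uncurry
      exact ENNReal.continuous_ofReal.comp (by fun_prop)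
    exact lintegral_lintegral_swap hc.measurable.aemeasurable
  have hin : ∀ z, ∫⁻ x, ENNReal.ofReal (k (x - z) ^ 2 / n)
      = ENNReal.ofReal ((∫ x, k x ^ 2) / n) := by
    intro z
    rw [lintegral_sub_right_eq_self (fun x => ENNReal.ofReal (k x ^ 2 / n)) z, ← integral_div,
      ofReal_integral_eq_lintegral_ofReal (hk2.div_const _) (ae_of_all _ fun z => by positivity)]
  have hswap := lintegral_lintegral_swap (μ := sampleLaw n f) (ν := volume)
    (f := fun y x => ‖kernelEstimator n k y x - ∫ z, k (x - z) ∂(law f)‖ₑ ^ 2)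
    (measurable_deviation hk hf).aemeasurable
  rw [hswap]
  calc _ ≤ ∫⁻ x, ∫⁻ z, ENNReal.ofReal (k (x - z) ^ 2 / n) ∂(law f) :=
        lintegral_mono fun x => lintegral_variance_le hn hk hb hf x
    _ = _ := by
        rw [hsw]
        simp_rw [hin]
        rw [lintegral_const, measure_univ, mul_one]

/-- Bias-variance bound for a kernel density estimator. -/
theorem risk_kernelEstimator_le {n : ℕ} (hn : 1 ≤ n) {k : ℝ → ℝ} (hk : Continuous k)
    (hk2 : Integrable fun x => k x ^ 2) (hb : ∃ B, ∀ x, |k x| ≤ B) {f : ℝ → ℝ} (hf : IsDensity f) :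
    risk n (kernelEstimator n k) f ≤ 2 * ENNReal.ofReal ((∫ x, k x ^ 2) / n)
      + 2 * ∫⁻ x, ‖∫ z, k (x - z) ∂(law f) - f x‖ₑ ^ 2 := by
  have := isProbabilityMeasure_law hf
  have : IsProbabilityMeasure (sampleLaw n f) := by unfold sampleLaw; infer_instance
  have hV := lintegral_lintegral_variance_le hn hk hk2 hb hf
  unfold risk
  calc _ ≤ ∫⁻ y, (2 * (∫⁻ x, ‖kernelEstimator n k y x - ∫ z, k (x - z) ∂(law f)‖ₑ ^ 2 ∂volume)
        + 2 * ∫⁻ x, ‖∫ z, k (x - z) ∂(law f) - f x‖ₑ ^ 2) ∂(sampleLaw n f) := by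
        refine lintegral_mono fun y => ?_
        rw [eLpNorm_two_sq]
        have hm : Measurable fun x => ‖kernelEstimator n k y x - ∫ z, k (x - z) ∂(law f)‖ₑ ^ 2 :=
          ((measurable_kernelEstimator n hk).of_uncurry_left.sub
            (measurable_smoothed hk hf)).enorm.pow_const 2
        rw [← lintegral_const_mul' _ _ ENNReal.ofNat_ne_top,
          ← lintegral_const_mul' _ _ ENNReal.ofNat_ne_top, ← lintegral_add_left (hm.const_mul 2)]
        refine lintegral_mono fun x => ?_
        have := enorm_add_sq_le (kernelEstimator n k y x - ∫ z, k (x - z) ∂(law f))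
          (∫ z, k (x - z) ∂(law f) - f x)
        rwa [sub_add_sub_cancel] at this
    _ ≤ _ := by
        rw [lintegral_add_right _ measurable_const, lintegral_const, measure_univ, mul_one,
          lintegral_const_mul' _ _ ENNReal.ofNat_ne_top]
        gcongr

/-- The smoothing bias over the logarithmic Sobolev class. -/
theorem lintegral_bias_le {k f : ℝ → ℝ} (hk : Integrable k) {γ δ L B : ℝ}
    (hB : 0 ≤ B) (h : ∀ t, ‖fourierHat k t - 1‖ ^ 2 ≤ B * weight γ δ t ^ 2)
    (hf : f ∈ densityClass γ δ L) :
    ∫⁻ x, ‖∫ z, k (x - z) ∂(law f) - f x‖ₑ ^ 2 ≤ ENNReal.ofReal (B * L ^ 2) := by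
  obtain ⟨hd, hfL⟩ := hf
  have hfi := hd.2.1
  let u : ℝ → ℝ := fun x => ∫ z, k (x - z) ∂(law f)
  have hconv : (fun x => (u x : ℂ))
      = convolution (fun x => (f x : ℂ)) (fun x => (k x : ℂ)) (ContinuousLinearMap.mul ℂ ℂ) volume := by
    ext x
    simp only [u, integral_law hd, convolution, ContinuousLinearMap.mul_apply']
    rw [← integral_complex_ofReal]
    push_cast
    rfl
  have hui : Integrable u := by
    have h1 : Integrable (fun x => (u x : ℂ)) := by
      rw [hconv]
      exact (integrable_coe hfi).integrable_convolution _ (integrable_coe hk)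
    simpa using h1.re
  have hhat : ∀ t, fourierHat (fun x => u x - f x) t = (fourierHat k t - 1) * fourierHat f t := by
    intro t
    have h1 : fourierHat u t = fourierHat f t * fourierHat k t := by
      rw [fourierHat_eq_fourier, hconv,
        Real.fourier_mul_convolution_eq (integrable_coe hfi) (integrable_coe hk),
        ← fourierHat_eq_fourier, ← fourierHat_eq_fourier]
    rw [fourierHat_sub hui hfi, h1]
    ring
  have hle : ∫⁻ t, ‖fourierHat (fun x => u x - f x) t‖ₑ ^ 2 ≤ ENNReal.ofReal (B * L ^ 2) := by
    rw [ENNReal.ofReal_mul hB]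
    refine le_trans ?_ (mul_le_mul_right hfL _)
    rw [eLpNorm_two_sq, ← lintegral_const_mul' _ _ ENNReal.ofReal_ne_top]
    refine lintegral_mono fun t => ?_
    rw [hhat, enorm_mul, mul_pow, enorm_mul, mul_pow, ← mul_assoc]
    gcongr
    rw [← ofReal_norm, ← ofReal_norm, ← ENNReal.ofReal_pow (norm_nonneg _),
      ← ENNReal.ofReal_pow (norm_nonneg _), ← ENNReal.ofReal_mul hB, Complex.norm_real,
      Real.norm_eq_abs, sq_abs]
    exact ENNReal.ofReal_le_ofReal (h t)
  -- The bound `hle` also supplies the finiteness that Plancherel requires. The factor 2π it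
  -- produces is at least 1 and is discarded.
  have hP := lintegral_fourierHat_sq (hui.sub hfi) (ne_top_of_le_ne_top ENNReal.ofReal_ne_top hle)
  change ∫⁻ t, ‖fourierHat (fun x => u x - f x) t‖ₑ ^ 2
    = ENNReal.ofReal (2 * Real.pi) * ∫⁻ x, ‖u x - f x‖ₑ ^ 2 at hP
  refine le_trans ?_ hle
  rw [hP]
  refine le_mul_of_one_le_left zero_le ?_
  rw [ENNReal.one_le_ofReal]
  linarith [Real.pi_gt_three]

end Risk

/-! ### The upper bound -/

section Upper

open Real

lemma weight_sq (γ δ t : ℝ) :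
    weight γ δ t ^ 2 = (1 + t ^ 2) ^ γ * log (exp 1 + |t|) ^ (-δ) := by
  have h1 : (1 : ℝ) ≤ log (exp 1 + |t|) := by
    rw [Real.le_log_iff_exp_le (by positivity)]
    linarith [abs_nonneg t]
  rw [weight, mul_pow, sq_abs, ← Real.rpow_mul_natCast (by positivity),
    ← Real.rpow_mul_natCast (by linarith)]
  norm_num

lemma one_le_log_exp_add (x : ℝ) (hx : 0 ≤ x) : 1 ≤ log (exp 1 + x) := by
  rw [Real.le_log_iff_exp_le (by positivity)]
  linarith

/-- Lower bound on the weight beyond the frequency `N`. -/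
lemma one_le_weight_sq {γ δ N t : ℝ} (hγ : 0 < γ) (hδ : 0 < δ) (hN : 0 < N) (ht : N ≤ |t|) :
    1 ≤ (1 + δ / (2 * γ)) ^ δ * N ^ (-(2 * γ)) * log (exp 1 + N) ^ δ * weight γ δ t ^ 2 := by
  set s := |t| / N with hs
  have hs1 : 1 ≤ s := by rwa [hs, one_le_div hN]
  have hts : |t| = N * s := by rw [hs]; field_simp
  have hl1 := one_le_log_exp_add |t| (abs_nonneg t)
  have hl2 := one_le_log_exp_add N hN.le
  have hε : 0 < 2 * γ / δ := by positivity
  -- Beyond N the logarithm grows by at most log s, which is bounded by a multiple of s^(2γ/δ). This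
  -- exponent is chosen so that the power δ yields s^(2γ), exactly what (1+t²)^γ absorbs.
  have hlog : log (exp 1 + |t|) ≤ log (exp 1 + N) * ((1 + δ / (2 * γ)) * s ^ (2 * γ / δ)) := by
    have h1 : log (exp 1 + |t|) ≤ log (exp 1 + N) + log s := by
      rw [← Real.log_mul (by positivity) (by positivity)]
      apply Real.log_le_log (by positivity)
      rw [hts]
      nlinarith [Real.exp_pos 1]
    have h2 : log s ≤ s ^ (2 * γ / δ) / (2 * γ / δ) := Real.log_le_rpow_div (by linarith) hε
    have h3 : s ^ (2 * γ / δ) / (2 * γ / δ) = δ / (2 * γ) * s ^ (2 * γ / δ) := by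
      field_simp
    have h4 : 1 ≤ s ^ (2 * γ / δ) := Real.one_le_rpow hs1 hε.le
    have h5 : 0 ≤ log s := Real.log_nonneg hs1
    have h6 : 1 + log s ≤ (1 + δ / (2 * γ)) * s ^ (2 * γ / δ) := by rw [h3] at h2; linarith
    calc _ ≤ log (exp 1 + N) * (1 + log s) := by nlinarith
      _ ≤ _ := by gcongr
  have hpow : log (exp 1 + |t|) ^ δ
      ≤ log (exp 1 + N) ^ δ * ((1 + δ / (2 * γ)) ^ δ * s ^ (2 * γ)) := by
    calc _ ≤ (log (exp 1 + N) * ((1 + δ / (2 * γ)) * s ^ (2 * γ / δ))) ^ δ :=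
          Real.rpow_le_rpow (by linarith) hlog hδ.le
      _ = _ := by
          rw [Real.mul_rpow (by linarith) (by positivity), Real.mul_rpow (by positivity) (by positivity),
            ← Real.rpow_mul (by linarith)]
          congr 3
          field_simp
  have hs2 : s ^ (2 * γ) ≤ N ^ (-(2 * γ)) * (1 + t ^ 2) ^ γ := by
    rw [hs, Real.div_rpow (abs_nonneg t) hN.le, Real.rpow_neg hN.le, div_eq_inv_mul]
    gcongr
    rw [Real.rpow_mul (abs_nonneg t)]
    apply Real.rpow_le_rpow (by positivity) _ hγ.le
    rw [Real.rpow_two, sq_abs]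
    linarith
  rw [weight_sq, Real.rpow_neg (by linarith : (0 : ℝ) ≤ log (exp 1 + |t|)), ← mul_assoc,
    ← div_eq_mul_inv, one_le_div (by positivity)]
  calc _ ≤ _ := hpow
    _ ≤ log (exp 1 + N) ^ δ * ((1 + δ / (2 * γ)) ^ δ * (N ^ (-(2 * γ)) * (1 + t ^ 2) ^ γ)) := by
        gcongr
    _ = _ := by ring

/-- Risk over the class of the kernel estimator with bandwidth `1 / N`. -/
theorem minimaxRisk_le {K : ℝ → ℝ} (hKc : Continuous K) (hKi : Integrable K)
    (hK2 : Integrable fun x => K x ^ 2) (hKb : ∃ B, ∀ x, |K x| ≤ B)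
    (hKhat : ∀ t, ‖fourierHat K t - 1‖ ≤ 1 ∧ (|t| ≤ 1 → fourierHat K t = 1))
    {γ δ : ℝ} (L : ℝ) {N : ℝ} (hγ : 0 < γ) (hδ : 0 < δ) (hN : 0 < N) {n : ℕ} (hn : 1 ≤ n) :
    minimaxRisk n (densityClass γ δ L) ≤ ENNReal.ofReal (2 * ((∫ x, K x ^ 2) * (N / n)
      + (1 + δ / (2 * γ)) ^ δ * N ^ (-(2 * γ)) * log (exp 1 + N) ^ δ * L ^ 2)) := by
  let k : ℝ → ℝ := fun x => N * K (N * x)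
  have hkc : Continuous k := by fun_prop
  have hki : Integrable k := (hKi.comp_mul_left' hN.ne').const_mul N
  have hksq : (fun x => k x ^ 2) = fun x => N ^ 2 * (fun x => K x ^ 2) (N * x) := by
    ext x; simp only [k]; ring
  have hk2 : Integrable fun x => k x ^ 2 := by
    rw [hksq]
    exact (hK2.comp_mul_left' hN.ne').const_mul _
  have hkint : ∫ x, k x ^ 2 = N * ∫ x, K x ^ 2 := by
    rw [hksq, integral_const_mul, Measure.integral_comp_mul_left (fun x => K x ^ 2) N, abs_of_pos (inv_pos.2 hN),
      smul_eq_mul]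
    field_simp
  have hkb : ∃ B, ∀ x, |k x| ≤ B := by
    obtain ⟨B, hB⟩ := hKb
    refine ⟨N * B, fun x => ?_⟩
    rw [abs_mul, abs_of_pos hN]
    gcongr
    exact hB _
  have hl := one_le_log_exp_add N hN.le
  set D := (1 + δ / (2 * γ)) ^ δ * N ^ (-(2 * γ)) * log (exp 1 + N) ^ δ with hD
  have hD0 : 0 ≤ D := by positivity
  have hkhat : ∀ t, ‖fourierHat k t - 1‖ ^ 2 ≤ D * weight γ δ t ^ 2 := by
    intro t
    rw [fourierHat_scale K hN]
    rcases le_total |t| N with h | h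
    · rw [(hKhat (t / N)).2 (by rwa [abs_div, abs_of_pos hN, div_le_one hN])]
      rw [sub_self, norm_zero, zero_pow two_ne_zero]
      positivity
    · calc _ ≤ (1 : ℝ) := pow_le_one₀ (norm_nonneg _) (hKhat (t / N)).1
        _ ≤ _ := one_le_weight_sq hγ hδ hN h
  have hI : 0 ≤ ∫ x, K x ^ 2 := integral_nonneg fun x => sq_nonneg _
  refine iInf₂_le_of_le (kernelEstimator n k) (measurable_kernelEstimator n hkc) (iSup₂_le ?_)
  intro f hf
  refine (risk_kernelEstimator_le hn hkc hk2 hkb hf.1).trans ?_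
  calc _ ≤ 2 * ENNReal.ofReal ((∫ x, k x ^ 2) / n) + 2 * ENNReal.ofReal (D * L ^ 2) := by
        gcongr
        exact lintegral_bias_le hki hD0 hkhat hf
    _ = _ := by
        rw [hkint, ← mul_add, ← ENNReal.ofReal_add (by positivity) (by positivity),
          ← ENNReal.ofReal_ofNat 2, ← ENNReal.ofReal_mul (by norm_num)]
        congr 1
        ring

/-- The frequency cutoff N solves N/n = N^(-2γ) (log n)^δ; both sides equal `R`. It remains to
replace log(e+N) by a multiple of log n. -/
theorem exists_minimaxRisk_le {γ : ℝ} (L : ℝ) (hγ : 0 < γ) {δ : ℝ} (hδ : 1 < δ) :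
    ∃ C : ℝ, 0 < C ∧ ∀ n : ℕ, 2 ≤ n → minimaxRisk n (densityClass γ δ L)
        ≤ ENNReal.ofReal (C * (rate n γ ^ 2 * log n ^ (δ / (2 * γ + 1)))) := by
  obtain ⟨K, hKc, hKi, hK2, hKb, hKhat⟩ := exists_kernel
  have hδ0 : 0 < δ := by linarith
  have hI : 0 ≤ ∫ x, K x ^ 2 := integral_nonneg fun x => sq_nonneg _
  have hlog2 : 0 < log 2 := Real.log_pos one_lt_two
  -- Comes from log(e+N) ≤ log(e+1) + (1+δ) log n, the first term being absorbed through log n ≥ log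
  -- 2.
  set M := log (exp 1 + 1) / log 2 + 1 + δ with hM
  have hle1 := one_le_log_exp_add 1 zero_le_one
  have hM0 : 0 < M := by positivity
  set D := (1 + δ / (2 * γ)) ^ δ with hD
  -- The final `+ 1` only secures positivity.
  refine ⟨2 * ((∫ x, K x ^ 2) + D * M ^ δ * L ^ 2) + 1, by positivity, fun n hn => ?_⟩
  have hn2 : (2 : ℝ) ≤ n := by exact_mod_cast hn
  have hn0 : (0 : ℝ) < n := by linarith
  set ℓ := log n with hℓ
  have hℓ2 : log 2 ≤ ℓ := Real.log_le_log two_pos hn2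
  have hℓ0 : 0 < ℓ := by linarith
  set N := (n * ℓ ^ δ) ^ (1 / (2 * γ + 1)) with hN
  have hN0 : 0 < N := by positivity
  have hg : (2 * γ + 1) ≠ 0 := by positivity
  set R := rate n γ ^ 2 * ℓ ^ (δ / (2 * γ + 1)) with hR
  have hR0 : 0 ≤ R := by positivity
  have hrate : rate n γ ^ 2 = (n : ℝ) ^ (-(2 * γ) / (2 * γ + 1)) := by
    rw [rate, ← Real.rpow_natCast, ← Real.rpow_mul hn0.le]
    congr 1
    push_cast
    ring
  have hNn : N / n = R := by
    rw [hN, hR, hrate, Real.mul_rpow hn0.le (by positivity), ← Real.rpow_mul hℓ0.le,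
      mul_div_right_comm]
    congr 1
    · nth_rewrite 2 [← Real.rpow_one (n : ℝ)]
      rw [← Real.rpow_sub hn0]
      congr 1
      field_simp
      ring
    · congr 1
      field_simp
  have hNb : N ^ (-(2 * γ)) * ℓ ^ δ = R := by
    rw [hN, hR, hrate, ← Real.rpow_mul (by positivity), Real.mul_rpow hn0.le (by positivity),
      ← Real.rpow_mul hℓ0.le, mul_assoc, ← Real.rpow_add hℓ0]
    congr 2
    · field_simp
    · field_simp
      ring
  have hlogN : log (exp 1 + N) ≤ M * ℓ := by
    -- Crude but enough inside a logarithm: log n ≤ n, and the outer exponent 1/(2γ+1) is at most 1.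
    have hNle : N ≤ (n : ℝ) ^ (1 + δ) := by
      have h1 : (1 : ℝ) ≤ (n : ℝ) ^ (1 + δ) := Real.one_le_rpow (by linarith) (by linarith)
      have h2 : n * ℓ ^ δ ≤ (n : ℝ) ^ (1 + δ) := by
        rw [Real.rpow_add hn0, Real.rpow_one]
        gcongr
        exact (Real.log_le_sub_one_of_pos hn0).trans (by linarith)
      calc N ≤ ((n : ℝ) ^ (1 + δ)) ^ (1 / (2 * γ + 1)) :=
            Real.rpow_le_rpow (by positivity) h2 (by positivity)
        _ ≤ ((n : ℝ) ^ (1 + δ)) ^ (1 : ℝ) := by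
            apply Real.rpow_le_rpow_of_exponent_le h1
            rw [div_le_one (by positivity)]
            linarith
        _ = _ := Real.rpow_one _
    have h1 : (1 : ℝ) ≤ (n : ℝ) ^ (1 + δ) := Real.one_le_rpow (by linarith) (by linarith)
    calc log (exp 1 + N) ≤ log ((exp 1 + 1) * (n : ℝ) ^ (1 + δ)) := by
          apply Real.log_le_log (by positivity)
          nlinarith [Real.exp_pos 1]
      _ = log (exp 1 + 1) + (1 + δ) * ℓ := by
          rw [Real.log_mul (by positivity) (by positivity), Real.log_rpow hn0]
      _ ≤ _ := by
          have h3 : log (exp 1 + 1) ≤ log (exp 1 + 1) / log 2 * ℓ := by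
            rw [div_mul_eq_mul_div, le_div_iff₀ hlog2]
            exact mul_le_mul_of_nonneg_left hℓ2 (by positivity)
          rw [hM]
          linarith
  have hl := one_le_log_exp_add N hN0.le
  refine (minimaxRisk_le hKc hKi hK2 hKb hKhat L hγ hδ0 hN0 (by omega)).trans
    (ENNReal.ofReal_le_ofReal ?_)
  have h2 : D * N ^ (-(2 * γ)) * log (exp 1 + N) ^ δ ≤ D * M ^ δ * R := by
    calc _ ≤ D * N ^ (-(2 * γ)) * (M * ℓ) ^ δ := by gcongr
      _ = _ := by rw [Real.mul_rpow hM0.le hℓ0.le, ← hNb]; ring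
  rw [hNn]
  calc _ ≤ 2 * ((∫ x, K x ^ 2) * R + D * M ^ δ * R * L ^ 2) := by gcongr
    _ ≤ _ := by nlinarith

end Upper

/-! ### Two-point bounds and Assouad's lemma -/

section Assouad

lemma sampleLaw_eq_withDensity (n : ℕ) {f : ℝ → ℝ} (hf : IsDensity f) :
    sampleLaw n f = volume.withDensity fun y => ∏ i, ENNReal.ofReal (f (y i)) := by
  have := isProbabilityMeasure_law hf
  refine Measure.pi_eq fun s hs => ?_
  rw [withDensity_apply _ (MeasurableSet.univ_pi hs), volume_pi, Measure.restrict_pi_pi]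
  have h1 : ∀ y : Fin n → ℝ, ∏ i, ENNReal.ofReal (f (y i)) = ENNReal.ofReal (∏ i, f (y i)) :=
    fun y => (ENNReal.ofReal_prod_of_nonneg fun i _ => hf.1 _).symm
  have h2 : ∀ i : Fin n, Integrable f ((volume : Measure ℝ).restrict (s i)) :=
    fun i => hf.2.1.restrict
  simp_rw [h1]
  rw [← ofReal_integral_eq_lintegral_ofReal
    (Integrable.fintype_prod (f := fun _ => f) h2)
    (ae_of_all _ fun y => Finset.prod_nonneg fun i _ => hf.1 _),
    integral_fintype_prod_eq_prod (f := fun _ : Fin n => f),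
    ENNReal.ofReal_prod_of_nonneg fun i _ => integral_nonneg hf.1]
  refine Finset.prod_congr rfl fun i _ => ?_
  rw [law, withDensity_apply _ (hs i), ofReal_integral_eq_lintegral_ofReal (h2 i)
    (ae_of_all _ hf.1)]

lemma integral_prod_density (n : ℕ) {f : ℝ → ℝ} (hf : IsDensity f) :
    Integrable (fun y : Fin n → ℝ => ∏ i, f (y i)) ∧ ∫ y : Fin n → ℝ, ∏ i, f (y i) = 1 := by
  refine ⟨Integrable.fintype_prod (f := fun _ => f) fun _ => hf.2.1, ?_⟩
  rw [integral_fintype_prod_volume_eq_pow f, hf.2.2, one_pow]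

/-- Hellinger affinity in terms of the `χ²`-type distance. -/
lemma affinity_ge {a b c : ℝ} (ha : 0 ≤ a) (hb : 0 ≤ b) (hc : 0 < c) (h : a = b ∨ 2 * c ≤ a + b) :
    (a + b) / 2 - (a - b) ^ 2 / (4 * c) ≤ √a * √b := by
  rcases h with rfl | h
  · simp [Real.mul_self_sqrt ha]
  -- √a √b equals (a+b)/2 - (√a-√b)²/2, and (√a-√b)² = (a-b)²/(√a+√b)² with (√a+√b)² ≥ a+b ≥ 2c.
  · have h1 := Real.sq_sqrt ha
    have h2 := Real.sq_sqrt hb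
    set u := √a
    set v := √b
    have hu : 0 ≤ u := Real.sqrt_nonneg _
    have hv : 0 ≤ v := Real.sqrt_nonneg _
    rw [← h1, ← h2] at h ⊢
    have h3 : 2 * c ≤ (u + v) ^ 2 := by nlinarith
    have h4 : (u - v) ^ 2 / 2 ≤ (u ^ 2 - v ^ 2) ^ 2 / (4 * c) := by
      rw [le_div_iff₀ (by positivity)]
      have : (u ^ 2 - v ^ 2) ^ 2 = (u - v) ^ 2 * (u + v) ^ 2 := by ring
      rw [this]
      nlinarith [sq_nonneg (u - v)]
    nlinarith

/-- Two product measures whose marginals are at squared distance of order `1 / n` overlap. -/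
theorem lintegral_min_ge {n : ℕ} (hn : 1 ≤ n) {f g : ℝ → ℝ} (hf : IsDensity f) (hg : IsDensity g)
    {c : ℝ} (hc : 0 < c)
    (hfg : ∀ x, f x = g x ∨ 2 * c ≤ f x + g x) (hi : Integrable fun x => (f x - g x) ^ 2)
    (hd : n * ∫ x, (f x - g x) ^ 2 ≤ c) :
    ENNReal.ofReal (1 / 4) ≤ ∫⁻ y : Fin n → ℝ,
      min (∏ i, ENNReal.ofReal (f (y i))) (∏ i, ENNReal.ofReal (g (y i))) := by
  have hn0 : (0 : ℝ) < n := by exact_mod_cast hn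
  have hn1 : (1 : ℝ) ≤ n := by exact_mod_cast hn
  let r : ℝ → ℝ := fun x => √(f x) * √(g x)
  have hr : Integrable r := by
    refine ((hf.2.1.add hg.2.1).div_const 2).mono'
      ((hf.2.1.aestronglyMeasurable.aemeasurable.sqrt.mul
        hg.2.1.aestronglyMeasurable.aemeasurable.sqrt).aestronglyMeasurable)
      (ae_of_all _ fun x => ?_)
    rw [Real.norm_eq_abs, abs_of_nonneg (by positivity)]
    simp only [Pi.add_apply]
    nlinarith [Real.sq_sqrt (hf.1 x), Real.sq_sqrt (hg.1 x), sq_nonneg (√(f x) - √(g x))]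
  have hρ : 1 - 1 / (4 * n) ≤ ∫ x, r x := by
    have h1 : ∫ x, ((f x + g x) / 2 - (f x - g x) ^ 2 / (4 * c)) ≤ ∫ x, r x :=
      integral_mono (((hf.2.1.add hg.2.1).div_const 2).sub (hi.div_const _)) hr
        fun x => affinity_ge (hf.1 x) (hg.1 x) hc (hfg x)
    have h2 : ∫ x, ((f x + g x) / 2 - (f x - g x) ^ 2 / (4 * c))
        = 1 - (∫ x, (f x - g x) ^ 2) / (4 * c) := by
      have h3 := integral_sub ((hf.2.1.add hg.2.1).div_const 2) (hi.div_const (4 * c))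
      simp only [Pi.add_apply] at h3
      rw [h3, integral_div, integral_div, integral_add hf.2.1 hg.2.1, hf.2.2, hg.2.2]
      norm_num
    have h4 : (∫ x, (f x - g x) ^ 2) / (4 * c) ≤ 1 / (4 * n) := by
      rw [div_le_div_iff₀ (by positivity) (by positivity)]
      linarith
    linarith
  have hρn : 3 / 4 ≤ (∫ x, r x) ^ n := by
    have h1 : 1 / (4 * (n : ℝ)) ≤ 1 / 4 := by
      rw [div_le_div_iff₀ (by positivity) (by positivity)]; linarith
    have h2 := one_add_mul_le_pow (a := -(1 / (4 * (n : ℝ)))) (by linarith) n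
    have h3 : (n : ℝ) * (1 / (4 * n)) = 1 / 4 := by field_simp
    calc (3 / 4 : ℝ) ≤ (1 + -(1 / (4 * (n : ℝ)))) ^ n := by linarith
      _ ≤ _ := pow_le_pow_left₀ (by linarith) (by linarith) n
  obtain ⟨hPi, hP⟩ := integral_prod_density n hf
  obtain ⟨hQi, hQ⟩ := integral_prod_density n hg
  have hRi : Integrable fun y : Fin n → ℝ => ∏ i, r (y i) :=
    Integrable.fintype_prod (f := fun _ => r) fun _ => hr
  have hR : ∫ y : Fin n → ℝ, ∏ i, r (y i) = (∫ x, r x) ^ n := by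
    rw [integral_fintype_prod_volume_eq_pow r, Fintype.card_fin]
  -- With u, v the square roots of the product densities, (u - 3v/8)² ≥ 0 gives u² ≥ (3/4)uv -
  -- (9/64)v², and symmetrically. After integration the bound is at least 9/16 - 9/32 = 9/32 > 1/4.
  have hpt : ∀ y : Fin n → ℝ, 3 / 4 * ∏ i, r (y i) - 9 / 64 * (∏ i, f (y i) + ∏ i, g (y i))
      ≤ min (∏ i, f (y i)) (∏ i, g (y i)) := by
    intro y
    have h1 : ∏ i, f (y i) = (∏ i, √(f (y i))) ^ 2 := by
      rw [← Finset.prod_pow]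
      exact Finset.prod_congr rfl fun i _ => (Real.sq_sqrt (hf.1 _)).symm
    have h2 : ∏ i, g (y i) = (∏ i, √(g (y i))) ^ 2 := by
      rw [← Finset.prod_pow]
      exact Finset.prod_congr rfl fun i _ => (Real.sq_sqrt (hg.1 _)).symm
    have h3 : ∏ i, r (y i) = (∏ i, √(f (y i))) * ∏ i, √(g (y i)) := Finset.prod_mul_distrib
    rw [h1, h2, h3]
    set u := ∏ i, √(f (y i))
    set v := ∏ i, √(g (y i))
    rw [le_min_iff]
    constructor <;> nlinarith [sq_nonneg (u - 3 / 8 * v), sq_nonneg (v - 3 / 8 * u)]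
  have hmin : ∀ y : Fin n → ℝ, min (∏ i, ENNReal.ofReal (f (y i))) (∏ i, ENNReal.ofReal (g (y i)))
      = ENNReal.ofReal (min (∏ i, f (y i)) (∏ i, g (y i))) := by
    intro y
    rw [← ENNReal.ofReal_prod_of_nonneg fun i _ => hf.1 _,
      ← ENNReal.ofReal_prod_of_nonneg fun i _ => hg.1 _]
    exact (ENNReal.ofReal_mono.map_min).symm
  simp_rw [hmin]
  have hmi : Integrable fun y : Fin n → ℝ => min (∏ i, f (y i)) (∏ i, g (y i)) := hPi.inf hQi
  rw [← ofReal_integral_eq_lintegral_ofReal hmi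
    (ae_of_all _ fun y => le_min (Finset.prod_nonneg fun i _ => hf.1 _)
      (Finset.prod_nonneg fun i _ => hg.1 _))]
  apply ENNReal.ofReal_le_ofReal
  have h5 := integral_mono ((hRi.const_mul (3 / 4)).sub ((hPi.add hQi).const_mul (9 / 64))) hmi hpt
  have h6 := integral_sub (hRi.const_mul (3 / 4)) ((hPi.add hQi).const_mul (9 / 64))
  simp only [Pi.add_apply] at h6
  simp only [Pi.sub_apply, Pi.add_apply] at h5
  rw [h6, integral_const_mul, integral_const_mul, integral_add hPi hQi, hP, hQ, hR] at h5
  linarith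

/-- Two-point bound for a sum of losses that cannot both be small. -/
theorem two_point_le {n : ℕ} (hn : 1 ≤ n) {f g : ℝ → ℝ} (hf : IsDensity f) (hg : IsDensity g)
    (hfm : Measurable f) (hgm : Measurable g) {c : ℝ} (hc : 0 < c)
    (hfg : ∀ x, f x = g x ∨ 2 * c ≤ f x + g x) (hi : Integrable fun x => (f x - g x) ^ 2)
    (hd : n * ∫ x, (f x - g x) ^ 2 ≤ c) {A B : (Fin n → ℝ) → ℝ≥0∞} (hA : Measurable A)
    (hB : Measurable B) {D : ℝ≥0∞} (hD : ∀ y, D ≤ A y + B y) :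
    D * ENNReal.ofReal (1 / 4) ≤ ∫⁻ y, A y ∂(sampleLaw n f) + ∫⁻ y, B y ∂(sampleLaw n g) := by
  have hPm : ∀ {h : ℝ → ℝ}, Measurable h →
      Measurable fun y : Fin n → ℝ => ∏ i, ENNReal.ofReal (h (y i)) := fun hh =>
    Finset.measurable_prod _ fun i _ => (hh.comp (measurable_pi_apply i)).ennreal_ofReal
  rw [sampleLaw_eq_withDensity n hf, sampleLaw_eq_withDensity n hg,
    lintegral_withDensity_eq_lintegral_mul _ (hPm hfm) hA,
    lintegral_withDensity_eq_lintegral_mul _ (hPm hgm) hB,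
    ← lintegral_add_left ((hPm hfm).mul hA)]
  calc D * ENNReal.ofReal (1 / 4) ≤ D * ∫⁻ y : Fin n → ℝ,
        min (∏ i, ENNReal.ofReal (f (y i))) (∏ i, ENNReal.ofReal (g (y i))) := by
        gcongr
        exact lintegral_min_ge hn hf hg hc hfg hi hd
    _ ≤ ∫⁻ y : Fin n → ℝ, D * min (∏ i, ENNReal.ofReal (f (y i))) (∏ i, ENNReal.ofReal (g (y i))) :=
        lintegral_const_mul_le _ _
    _ ≤ _ := by
        refine lintegral_mono fun y => ?_
        calc _ ≤ (A y + B y) * min (∏ i, ENNReal.ofReal (f (y i))) (∏ i, ENNReal.ofReal (g (y i))) := by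
              gcongr
              exact hD y
          _ ≤ _ := by
              rw [add_mul, mul_comm (A y), mul_comm (B y)]
              simp only [Pi.mul_apply]
              gcongr
              · exact min_le_left _ _
              · exact min_le_right _ _

/-- The vertex of the hypercube obtained by switching one coordinate. -/
def flipAt {m : ℕ} (k : Fin m) (θ : Fin m → Bool) : Fin m → Bool := Function.update θ k (!θ k)

lemma flipAt_involutive {m : ℕ} (k : Fin m) : Function.Involutive (flipAt k) := by
  intro θ
  simp [flipAt]

/-- **Assouad's lemma** for the integrated squared error. -/
theorem le_minimaxRisk_of_hypercube {m n : ℕ} (hn : 1 ≤ n) {F : Set (ℝ → ℝ)}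
    (f : (Fin m → Bool) → ℝ → ℝ) (hF : ∀ θ, f θ ∈ F) (hf : ∀ θ, IsDensity (f θ))
    (hfm : ∀ θ, Measurable (f θ)) {c : ℝ} (hc : 0 < c)
    (hfg : ∀ θ k x, f θ x = f (flipAt k θ) x ∨ 2 * c ≤ f θ x + f (flipAt k θ) x)
    (hi : ∀ θ k, Integrable fun x => (f θ x - f (flipAt k θ) x) ^ 2)
    (hd : ∀ θ k, n * ∫ x, (f θ x - f (flipAt k θ) x) ^ 2 ≤ c)
    (I : Fin m → Set ℝ) (hI : ∀ k, MeasurableSet (I k)) (hdisj : Pairwise (Function.onFun Disjoint I))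
    {D : ℝ} (hD : 0 ≤ D)
    (hsep : ∀ θ k, ENNReal.ofReal D ≤ ∫⁻ x in I k, ‖f θ x - f (flipAt k θ) x‖ₑ ^ 2) :
    ENNReal.ofReal (m * D / 16) ≤ minimaxRisk n F := by
  refine le_iInf₂ fun est hest => ?_
  set S := ⨆ f ∈ F, risk n est f with hS
  let A : (Fin m → Bool) → Fin m → (Fin n → ℝ) → ℝ≥0∞ := fun θ k y =>
    ∫⁻ x in I k, ‖est y x - f θ x‖ₑ ^ 2
  have hloss : ∀ θ, Measurable fun p : (Fin n → ℝ) × ℝ => ‖est p.1 p.2 - f θ p.2‖ₑ ^ 2 := fun θ =>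
    (Measurable.sub hest ((hfm θ).comp measurable_snd)).enorm.pow_const 2
  have hAm : ∀ θ k, Measurable (A θ k) := fun θ k => (hloss θ).lintegral_prod_right'
  have hrisk : ∀ θ, ∑ k, ∫⁻ y, A θ k y ∂(sampleLaw n (f θ)) ≤ S := by
    intro θ
    refine le_trans ?_ (le_iSup₂ (f := fun f (_ : f ∈ F) => risk n est f) (f θ) (hF θ))
    rw [← lintegral_finsetSum _ fun k _ => hAm θ k]
    refine lintegral_mono fun y => ?_
    rw [eLpNorm_two_sq]
    have h1 : ∑ k, A θ k y = ∫⁻ x in ⋃ k, I k, ‖est y x - f θ x‖ₑ ^ 2 := by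
      rw [lintegral_iUnion hI hdisj, tsum_fintype]
    rw [h1]
    exact setLIntegral_le_lintegral _ _
  -- D/8 is D/2, from the squared triangle inequality, times the overlap 1/4.
  have hpair : ∀ θ k, ENNReal.ofReal (D / 8) ≤ ∫⁻ y, A θ k y ∂(sampleLaw n (f θ))
      + ∫⁻ y, A (flipAt k θ) k y ∂(sampleLaw n (f (flipAt k θ))) := by
    intro θ k
    have h1 : ∀ y, ENNReal.ofReal (D / 2) ≤ A θ k y + A (flipAt k θ) k y := by
      intro y
      have hm : ∀ θ, Measurable fun x => ‖est y x - f θ x‖ₑ ^ 2 := fun θ =>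
        ((hest.of_uncurry_left (x := y)).sub (hfm θ)).enorm.pow_const 2
      have h2 : ENNReal.ofReal D ≤ 2 * (A θ k y + A (flipAt k θ) k y) := by
        refine (hsep θ k).trans ?_
        rw [← lintegral_add_left (hm θ), ← lintegral_const_mul' _ _ ENNReal.ofNat_ne_top]
        refine lintegral_mono fun x => ?_
        have h3 := enorm_add_sq_le (-(est y x - f θ x)) (est y x - f (flipAt k θ) x)
        rw [enorm_neg, ← mul_add] at h3
        convert h3 using 3
        ring
      rw [ENNReal.ofReal_div_of_pos two_pos, ENNReal.ofReal_ofNat]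
      exact ENNReal.div_le_of_le_mul' h2
    have h4 := two_point_le hn (hf θ) (hf (flipAt k θ)) (hfm θ) (hfm _) hc (hfg θ k) (hi θ k) (hd θ k)
      (hAm θ k) (hAm (flipAt k θ) k) h1
    rw [← ENNReal.ofReal_mul (by positivity)] at h4
    convert h4 using 2
    ring
  have hsum : ∀ k, ∑ θ : Fin m → Bool, ENNReal.ofReal (D / 16)
      ≤ ∑ θ, ∫⁻ y, A θ k y ∂(sampleLaw n (f θ)) := by
    intro k
    set R : (Fin m → Bool) → ℝ≥0∞ := fun θ => ∫⁻ y, A θ k y ∂(sampleLaw n (f θ)) with hR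
    -- Flipping is an involution of the hypercube, so each vertex is counted twice; this turns D/8
    -- into D/16.
    have h1 : ∑ θ, R (flipAt k θ) = ∑ θ, R θ :=
      Equiv.sum_comp (flipAt_involutive k).toPerm R
    have h2 : ∑ θ : Fin m → Bool, ENNReal.ofReal (D / 8) ≤ 2 * ∑ θ, R θ := by
      calc _ ≤ ∑ θ, (R θ + R (flipAt k θ)) := Finset.sum_le_sum fun θ _ => hpair θ k
        _ = _ := by rw [Finset.sum_add_distrib, h1, two_mul]
    have h3 : ENNReal.ofReal (D / 8) = 2 * ENNReal.ofReal (D / 16) := by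
      rw [← ENNReal.ofReal_ofNat 2, ← ENNReal.ofReal_mul (by norm_num)]
      congr 1
      ring
    rw [h3, ← Finset.mul_sum] at h2
    exact (ENNReal.mul_le_mul_iff_right two_ne_zero ENNReal.ofNat_ne_top).1 h2
  -- The average over the hypercube is bounded by the supremum; both sides are kept multiplied by
  -- 2^m, cancelled at the end.
  have htot : (Fintype.card (Fin m → Bool) : ℝ≥0∞) * ENNReal.ofReal (m * D / 16)
      ≤ (Fintype.card (Fin m → Bool) : ℝ≥0∞) * S := by
    calc _ = ∑ k : Fin m, ∑ θ : Fin m → Bool, ENNReal.ofReal (D / 16) := by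
          simp only [Finset.sum_const, Finset.card_univ, nsmul_eq_mul, Fintype.card_fin]
          rw [mul_div_assoc, ENNReal.ofReal_mul (by positivity), ENNReal.ofReal_natCast]
          ring
      _ ≤ ∑ k, ∑ θ, ∫⁻ y, A θ k y ∂(sampleLaw n (f θ)) := Finset.sum_le_sum fun k _ => hsum k
      _ = ∑ θ, ∑ k, ∫⁻ y, A θ k y ∂(sampleLaw n (f θ)) := Finset.sum_comm
      _ ≤ ∑ θ : Fin m → Bool, S := Finset.sum_le_sum fun θ _ => hrisk θ
      _ = _ := by simp [Finset.sum_const, Finset.card_univ, nsmul_eq_mul]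
  exact (ENNReal.mul_le_mul_iff_right (by simp) (ENNReal.natCast_ne_top _)).1 htot

end Assouad

/-! ### Perturbations and the base density -/

section Construction

/-- Signed superposition of the translates of `ψ` at scale `1 / m`. -/
noncomputable def superposition {m : ℕ} (s : Fin m → ℝ) (ψ : ℝ → ℝ) (x : ℝ) : ℝ :=
  ∑ k : Fin m, s k * ψ (m * x - (k : ℕ))

variable {m : ℕ} {s : Fin m → ℝ} {ψ : ℝ → ℝ}

/-- Two integer shifts putting the same point into (0, 1) differ by less than one, hence are equal.
This is what kills all cross terms below. -/
lemma eq_zero_or_eq_zero (hψ : ∀ x, x ∉ Set.Ioo (0 : ℝ) 1 → ψ x = 0) {j k : Fin m} (hjk : j ≠ k)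
    (x : ℝ) : ψ (m * x - (j : ℕ)) = 0 ∨ ψ (m * x - (k : ℕ)) = 0 := by
  by_contra! h
  obtain ⟨h1, h2⟩ := h
  have h1' : m * x - ((j : ℕ) : ℝ) ∈ Set.Ioo (0 : ℝ) 1 := by
    by_contra h3; exact h1 (hψ _ h3)
  have h2' : m * x - ((k : ℕ) : ℝ) ∈ Set.Ioo (0 : ℝ) 1 := by
    by_contra h3; exact h2 (hψ _ h3)
  obtain ⟨a1, a2⟩ := h1'
  obtain ⟨b1, b2⟩ := h2'
  have c1 : ((j : ℕ) : ℝ) < (k : ℕ) + 1 := by linarith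
  have c2 : ((k : ℕ) : ℝ) < (j : ℕ) + 1 := by linarith
  have d1 : (j : ℕ) < k + 1 := by exact_mod_cast c1
  have d2 : (k : ℕ) < j + 1 := by exact_mod_cast c2
  exact hjk (Fin.ext (by omega))

lemma mem_Icc_of_mem_Ioo (k : Fin m) {x : ℝ} (h : m * x - ((k : ℕ) : ℝ) ∈ Set.Ioo (0 : ℝ) 1) :
    x ∈ Set.Icc (0 : ℝ) 1 := by
  obtain ⟨h1, h2⟩ := h
  have hm : (0 : ℝ) < m := by exact_mod_cast k.pos
  have hk0 : (0 : ℝ) ≤ (k : ℕ) := by positivity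
  have hk : ((k : ℕ) : ℝ) + 1 ≤ m := by exact_mod_cast k.2
  constructor
  · by_contra! h; nlinarith
  · by_contra! h; nlinarith

lemma superposition_eq_zero (hψ : ∀ x, x ∉ Set.Ioo (0 : ℝ) 1 → ψ x = 0) {x : ℝ}
    (hx : x ∉ Set.Icc (0 : ℝ) 1) : superposition s ψ x = 0 := by
  refine Finset.sum_eq_zero fun k _ => ?_
  rw [hψ _ fun h => hx (mem_Icc_of_mem_Ioo k h), mul_zero]

lemma superposition_sq (hψ : ∀ x, x ∉ Set.Ioo (0 : ℝ) 1 → ψ x = 0) (x : ℝ) :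
    superposition s ψ x ^ 2 = ∑ k : Fin m, s k ^ 2 * ψ (m * x - (k : ℕ)) ^ 2 := by
  rw [superposition, sq, Finset.sum_mul_sum]
  refine Finset.sum_congr rfl fun j _ => ?_
  rw [Finset.sum_eq_single j]
  · ring
  · intro k _ hk
    rcases eq_zero_or_eq_zero hψ hk x with h | h <;> rw [h] <;> ring
  · simp

lemma abs_superposition_le (hψ : ∀ x, x ∉ Set.Ioo (0 : ℝ) 1 → ψ x = 0) (hs : ∀ k, |s k| ≤ 1)
    (hb : ∀ x, |ψ x| ≤ 1) (x : ℝ) : |superposition s ψ x| ≤ 1 := by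
  by_cases h : ∃ k : Fin m, ψ (m * x - (k : ℕ)) ≠ 0
  · obtain ⟨k, hk⟩ := h
    rw [superposition, Finset.sum_eq_single k]
    · rw [abs_mul]
      exact mul_le_one₀ (hs k) (abs_nonneg _) (hb _)
    · intro j _ hj
      rw [(eq_zero_or_eq_zero hψ hj x).resolve_right hk, mul_zero]
    · simp
  · push Not at h
    simp [superposition, h]

lemma contDiff_superposition (hψ : ContDiff ℝ (⊤ : ℕ∞) ψ) :
    ContDiff ℝ (⊤ : ℕ∞) (superposition s ψ) := by
  unfold superposition
  exact ContDiff.sum fun k _ => contDiff_const.mul (hψ.comp (by fun_prop))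

lemma hasCompactSupport_superposition (hψ : ∀ x, x ∉ Set.Ioo (0 : ℝ) 1 → ψ x = 0) :
    HasCompactSupport (superposition s ψ) :=
  HasCompactSupport.intro isCompact_Icc fun _ hx => superposition_eq_zero hψ hx

/-- Derivatives remain superpositions, so their L² norms fall under `integral_superposition_sq`. -/
lemma iteratedDeriv_superposition (hψ : ContDiff ℝ (⊤ : ℕ∞) ψ) (j : ℕ) :
    iteratedDeriv j (superposition s ψ)
      = fun x => (m : ℝ) ^ j * superposition s (iteratedDeriv j ψ) x := by
  induction j with
  | zero => simp
  | succ j ih =>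
    rw [iteratedDeriv_succ, ih]
    ext x
    have hd : Differentiable ℝ (iteratedDeriv j ψ) :=
      (contDiff_iteratedDeriv hψ j).differentiable (by simp)
    have h1 : ∀ k : Fin m, HasDerivAt (fun x => s k * iteratedDeriv j ψ (m * x - (k : ℕ)))
        (s k * (iteratedDeriv (j + 1) ψ (m * x - (k : ℕ)) * m)) x := by
      intro k
      have h2 : HasDerivAt (fun x : ℝ => (m : ℝ) * x - (k : ℕ)) m x := by
        simpa using ((hasDerivAt_id x).const_mul (m : ℝ)).sub_const ((k : ℕ) : ℝ)
      rw [iteratedDeriv_succ]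
      exact ((hd _).hasDerivAt.comp x h2).const_mul (s k)
    have h3 : HasDerivAt (superposition s (iteratedDeriv j ψ))
        (∑ k, s k * (iteratedDeriv (j + 1) ψ (m * x - (k : ℕ)) * m)) x := by
      unfold superposition
      exact HasDerivAt.fun_sum fun k _ => h1 k
    rw [(h3.const_mul ((m : ℝ) ^ j)).deriv, superposition, pow_succ, mul_assoc]
    congr 1
    rw [Finset.mul_sum]
    exact Finset.sum_congr rfl fun k _ => by ring

lemma integral_comp_affine (g : ℝ → ℝ) (hm : 0 < m) (k : ℕ) :
    ∫ x : ℝ, g (m * x - k) = (∫ x, g x) / m := by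
  have h0 : (0 : ℝ) < m := by exact_mod_cast hm
  rw [Measure.integral_comp_mul_left (fun y : ℝ => g (y - k)) (m : ℝ),
    integral_sub_right_eq_self g, abs_of_pos (inv_pos.2 h0), smul_eq_mul]
  field_simp

lemma integrable_comp_affine {g : ℝ → ℝ} (hg : Integrable g) (hm : 0 < m) (k : ℕ) :
    Integrable fun x : ℝ => g (m * x - k) := by
  have h0 : (m : ℝ) ≠ 0 := by exact_mod_cast hm.ne'
  exact (hg.comp_sub_right (k : ℝ)).comp_mul_left' h0

lemma integral_superposition (hi : Integrable ψ) (h0 : ∫ x, ψ x = 0) (hm : 0 < m) :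
    ∫ x, superposition s ψ x = 0 := by
  unfold superposition
  rw [integral_finsetSum _ fun k _ => (integrable_comp_affine hi hm _).const_mul _]
  refine Finset.sum_eq_zero fun k _ => ?_
  rw [integral_const_mul, integral_comp_affine ψ hm, h0, zero_div, mul_zero]

/-- There are m disjoint blocks, each carrying 1/m of the squared norm; signs and m drop out. -/
lemma integral_superposition_sq (hψ : ∀ x, x ∉ Set.Ioo (0 : ℝ) 1 → ψ x = 0)
    (hi : Integrable fun x => ψ x ^ 2) (hs : ∀ k, s k ^ 2 = 1) (hm : 0 < m) :
    ∫ x, superposition s ψ x ^ 2 = ∫ x, ψ x ^ 2 := by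
  have h0 : (m : ℝ) ≠ 0 := by exact_mod_cast hm.ne'
  simp_rw [superposition_sq hψ, hs, one_mul]
  rw [integral_finsetSum _ fun k _ => integrable_comp_affine hi hm _]
  simp_rw [integral_comp_affine (fun x => ψ x ^ 2) hm]
  simp
  field_simp

/-- A smooth compactly supported oscillation. -/
lemma exists_wavelet : ∃ φ : ℝ → ℝ, ContDiff ℝ (⊤ : ℕ∞) φ ∧ tsupport φ ⊆ Set.Ioo 0 1 ∧
    ∫ x, φ x = 0 ∧ 0 < ∫ x, φ x ^ 2 ∧ ∀ x, |φ x| ≤ 1 := by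
  let b : ContDiffBump (0 : ℝ) := ⟨1 / 16, 1 / 8, by norm_num, by norm_num⟩
  have hb0 : ∀ y, 1 / 8 ≤ |y| → b y = 0 := fun y hy =>
    b.zero_of_le_dist (by rwa [Real.dist_eq, sub_zero])
  -- Two disjoint copies of a bump with opposite signs: the mean vanishes, the function does not.
  let φ : ℝ → ℝ := fun x => b (x - 1 / 4) - b (x - 3 / 4)
  have hφ : ContDiff ℝ (⊤ : ℕ∞) φ := by
    have := b.contDiff (n := (⊤ : ℕ∞))
    exact (this.comp (by fun_prop)).sub (this.comp (by fun_prop))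
  have hsupp : Function.support φ ⊆ Set.Icc (1 / 8) (7 / 8) := by
    intro x hx
    by_contra h
    apply hx
    have h1 : 1 / 8 ≤ |x - 1 / 4| ∧ 1 / 8 ≤ |x - 3 / 4| := by
      rw [Set.mem_Icc, not_and_or, not_le, not_le] at h
      rcases h with h | h
      · constructor <;> rw [abs_of_neg (by linarith)] <;> linarith
      · constructor <;> rw [abs_of_pos (by linarith)] <;> linarith
    simp only [φ, hb0 _ h1.1, hb0 _ h1.2, sub_zero]
  have htsupp : tsupport φ ⊆ Set.Icc (1 / 8) (7 / 8) := closure_minimal hsupp isClosed_Icc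
  have hc : HasCompactSupport φ := isCompact_Icc.of_isClosed_subset (isClosed_tsupport _) htsupp
  refine ⟨φ, hφ, htsupp.trans fun x hx => ⟨by linarith [hx.1], by linarith [hx.2]⟩, ?_, ?_, ?_⟩
  · have hi : Integrable b := b.integrable
    simp only [φ]
    rw [integral_sub (hi.comp_sub_right _) (hi.comp_sub_right _), integral_sub_right_eq_self,
      integral_sub_right_eq_self, sub_self]
  · have hne : φ (1 / 4) = 1 := by
      simp only [φ]
      rw [sub_self, hb0 (1 / 4 - 3 / 4) (by rw [abs_of_neg (by norm_num)]; norm_num), sub_zero]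
      exact b.one_of_mem_closedBall (Metric.mem_closedBall_self (by norm_num))
    refine Continuous.integral_pos_of_hasCompactSupport_nonneg_nonzero (x := 1 / 4)
      (hφ.continuous.pow 2) ?_ (fun x => sq_nonneg _) (by rw [hne]; norm_num)
    simp only [pow_two]
    exact hc.mul_right
  · intro x
    rw [abs_le]
    constructor <;> simp only [φ] <;>
      linarith [b.nonneg (x := x - 1 / 4), b.le_one (x := x - 1 / 4), b.nonneg (x := x - 3 / 4),
        b.le_one (x := x - 3 / 4)]

/-- A smooth compactly supported density, bounded below on the unit interval, with small Sobolev
norm. -/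
lemma exists_base_density {γ ε : ℝ} (hγ : 0 < γ) (hε : 0 < ε) : ∃ f₀ : ℝ → ℝ, IsDensity f₀ ∧
    ContDiff ℝ (⊤ : ℕ∞) f₀ ∧ HasCompactSupport f₀ ∧
    (∃ c, 0 < c ∧ ∀ x ∈ Set.Icc (0 : ℝ) 1, c ≤ f₀ x) ∧
    ∫⁻ t, ENNReal.ofReal ((1 + t ^ 2) ^ γ) * ‖fourierHat f₀ t‖ₑ ^ 2 ≤ ENNReal.ofReal ε := by
  let b : ContDiffBump (0 : ℝ) := ⟨1, 2, one_pos, one_lt_two⟩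
  set Φ : ℝ → ℝ := b.normed volume with hΦ
  have hΦs : ContDiff ℝ (⊤ : ℕ∞) Φ := b.contDiff_normed
  have hΦc : HasCompactSupport Φ := b.hasCompactSupport_normed
  have hΦi : Integrable Φ := b.integrable_normed
  set k := ⌈γ⌉₊ with hk
  set E := (∫ x, Φ x ^ 2) + ∫ x, iteratedDeriv k Φ x ^ 2 with hE
  have hA0 : 0 ≤ ∫ x, Φ x ^ 2 := integral_nonneg fun x => sq_nonneg _
  have hB0 : 0 ≤ ∫ x, iteratedDeriv k Φ x ^ 2 := integral_nonneg fun x => sq_nonneg _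
  have hC := sobolevConst_pos k
  -- Spreading the density out by 1/h multiplies its squared L² norm by h, and that of its
  -- derivative by at most h. Keeping h ≤ 1 leaves [0, 1] inside the plateau of the dilated bump;
  -- the `+ 1` avoids a zero denominator.
  set h := min 1 (ε / (sobolevConst k * E + 1)) with hh
  have hh0 : 0 < h := by positivity
  have hh1 : h ≤ 1 := min_le_left _ _
  have hhε : h * (sobolevConst k * E) ≤ ε := by
    have h1 : h ≤ ε / (sobolevConst k * E + 1) := min_le_right _ _
    rw [le_div_iff₀ (by positivity)] at h1
    linarith
  let f₀ : ℝ → ℝ := fun x => h * Φ (h * x)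
  have hfs : ContDiff ℝ (⊤ : ℕ∞) f₀ := contDiff_const.mul (hΦs.comp (by fun_prop))
  have hsc : ∀ g : ℝ → ℝ, ∫ x, g (h * x) = h⁻¹ * ∫ x, g x := fun g => by
    rw [Measure.integral_comp_mul_left, abs_of_pos (inv_pos.2 hh0), smul_eq_mul]
  have hfc : HasCompactSupport f₀ := by
    have h1 : HasCompactSupport fun x => Φ (h * x) :=
      hΦc.comp_homeomorph (Homeomorph.mulLeft₀ h hh0.ne')
    exact h1.mul_left
  refine ⟨f₀, ⟨fun x => mul_nonneg hh0.le (b.nonneg_normed _),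
    (hΦi.comp_mul_left' hh0.ne').const_mul _, ?_⟩, hfs, hfc, ?_, ?_⟩
  · simp only [f₀]
    rw [integral_const_mul, hsc Φ, hΦ, b.integral_normed, mul_one, mul_inv_cancel₀ hh0.ne']
  · refine ⟨h * (1 / ∫ x, b x), by have := b.integral_pos (μ := volume); positivity, fun x hx => ?_⟩
    simp only [f₀, hΦ, b.normed_def]
    rw [b.one_of_mem_closedBall]
    rw [Metric.mem_closedBall, dist_zero_right, Real.norm_eq_abs,
      abs_of_nonneg (mul_nonneg hh0.le hx.1)]
    exact mul_le_one₀ hh1 hx.1 hx.2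
  · refine (lintegral_sobolev_le hfs hfc hγ (Nat.le_ceil γ) one_pos le_rfl).trans
      (ENNReal.ofReal_le_ofReal ?_)
    have h1 : ∫ x, f₀ x ^ 2 = h * ∫ x, Φ x ^ 2 := by
      have : ∀ x, f₀ x ^ 2 = h ^ 2 * (fun y => Φ y ^ 2) (h * x) := fun x => by simp only [f₀]; ring
      simp_rw [this]
      rw [integral_const_mul, hsc (fun y => Φ y ^ 2)]
      field_simp
    have h2 : ∫ x, iteratedDeriv k f₀ x ^ 2 ≤ h * ∫ x, iteratedDeriv k Φ x ^ 2 := by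
      have h3 : iteratedDeriv k f₀ = fun x => h * (h ^ k * iteratedDeriv k Φ (h * x)) := by
        ext x
        simp only [f₀]
        rw [iteratedDeriv_const_mul_field, iteratedDeriv_comp_const_mul (hΦs.of_le (by exact_mod_cast le_top))]
      have h4 : ∀ x, iteratedDeriv k f₀ x ^ 2
          = h ^ 2 * (h ^ k) ^ 2 * (fun y => iteratedDeriv k Φ y ^ 2) (h * x) := fun x => by
        rw [h3]; ring
      simp_rw [h4]
      rw [integral_const_mul, hsc (fun y => iteratedDeriv k Φ y ^ 2)]
      have h5 : (h ^ k) ^ 2 ≤ 1 := pow_le_one₀ (by positivity) (pow_le_one₀ hh0.le hh1)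
      have h6 : h ^ 2 * (h ^ k) ^ 2 * (h⁻¹ * ∫ x, iteratedDeriv k Φ x ^ 2)
          = (h ^ k) ^ 2 * (h * ∫ x, iteratedDeriv k Φ x ^ 2) := by field_simp
      rw [h6]
      exact mul_le_of_le_one_left (by positivity) h5
    rw [Real.one_rpow, one_pow, one_mul, one_mul, ← hk, h1]
    calc _ ≤ sobolevConst k * (h * (∫ x, Φ x ^ 2) + h * ∫ x, iteratedDeriv k Φ x ^ 2) := by gcongr
      _ = h * (sobolevConst k * E) := by rw [hE]; ring
      _ ≤ ε := hhε

/-- Sums of two test functions with small Sobolev norm belong to the logarithmic Sobolev class. -/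
lemma add_mem_densityClass {γ δ L : ℝ} (hδ : 0 ≤ δ) {f g : ℝ → ℝ} (hf : Integrable f)
    (hg : Integrable g) (hd : IsDensity fun x => f x + g x)
    (hfS : ∫⁻ t, ENNReal.ofReal ((1 + t ^ 2) ^ γ) * ‖fourierHat f t‖ₑ ^ 2
      ≤ ENNReal.ofReal (L ^ 2 / 4))
    (hgS : ∫⁻ t, ENNReal.ofReal ((1 + t ^ 2) ^ γ) * ‖fourierHat g t‖ₑ ^ 2
      ≤ ENNReal.ofReal (L ^ 2 / 4)) :
    (fun x => f x + g x) ∈ densityClass γ δ L := by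
  refine ⟨hd, ?_⟩
  have hpt : ∀ a b : ℂ, ‖a + b‖ₑ ^ 2 ≤ 2 * ‖a‖ₑ ^ 2 + 2 * ‖b‖ₑ ^ 2 := by
    intro a b
    have h : ∀ z : ℂ, ‖z‖ₑ ^ 2 = ENNReal.ofReal (‖z‖ ^ 2) := fun z => by
      rw [← ofReal_norm, ← ENNReal.ofReal_pow (norm_nonneg _)]
    rw [h, h, h, ← ENNReal.ofReal_ofNat 2, ← ENNReal.ofReal_mul (by norm_num),
      ← ENNReal.ofReal_mul (by norm_num), ← ENNReal.ofReal_add (by positivity) (by positivity)]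
    apply ENNReal.ofReal_le_ofReal
    nlinarith [norm_add_le a b, norm_nonneg (a + b), sq_nonneg (‖a‖ - ‖b‖)]
  have hm : Measurable fun t => ENNReal.ofReal ((1 + t ^ 2) ^ γ) * ‖fourierHat f t‖ₑ ^ 2 := by
    have h1 := (continuous_fourierHat hf).measurable
    fun_prop
  rw [eLpNorm_two_sq]
  calc _ ≤ ∫⁻ t, (2 * (ENNReal.ofReal ((1 + t ^ 2) ^ γ) * ‖fourierHat f t‖ₑ ^ 2)
        + 2 * (ENNReal.ofReal ((1 + t ^ 2) ^ γ) * ‖fourierHat g t‖ₑ ^ 2)) := by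
        refine lintegral_mono fun t => ?_
        rw [enorm_mul, mul_pow, fourierHat_add hf hg, mul_left_comm, mul_left_comm 2, ← mul_add]
        refine mul_le_mul' ?_ (hpt _ _)
        rw [← ofReal_norm, ← ENNReal.ofReal_pow (norm_nonneg _), Complex.norm_real,
          Real.norm_eq_abs, sq_abs, weight_sq]
        apply ENNReal.ofReal_le_ofReal
        -- The logarithmic factor is at most 1; here δ disappears from the lower bound.
        exact mul_le_of_le_one_right (by positivity)
          (Real.rpow_le_one_of_one_le_of_nonpos (one_le_log_exp_add _ (abs_nonneg t)) (by linarith))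
    _ ≤ 2 * ENNReal.ofReal (L ^ 2 / 4) + 2 * ENNReal.ofReal (L ^ 2 / 4) := by
        rw [lintegral_add_left (hm.const_mul 2), lintegral_const_mul' _ _ ENNReal.ofNat_ne_top,
          lintegral_const_mul' _ _ ENNReal.ofNat_ne_top]
        gcongr
    _ = _ := by
        rw [← ENNReal.ofReal_ofNat 2, ← ENNReal.ofReal_mul (by norm_num),
          ← ENNReal.ofReal_add (by positivity) (by positivity)]
        congr 1
        ring

/-- At scale h = 1/m, the factor m^(2k) from differentiating k times cancels h^(2k), leaving h^(-2γ)
= m^(2γ). -/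
lemma lintegral_sobolev_superposition_le {γ : ℝ} (hγ : 0 < γ) {φ : ℝ → ℝ}
    (hφ : ContDiff ℝ (⊤ : ℕ∞) φ) (hsupp : tsupport φ ⊆ Set.Ioo 0 1) (hm : 0 < m)
    (hs : ∀ k, s k ^ 2 = 1) (a : ℝ) :
    ∫⁻ t, ENNReal.ofReal ((1 + t ^ 2) ^ γ) * ‖fourierHat (fun x => a * superposition s φ x) t‖ₑ ^ 2
      ≤ ENNReal.ofReal ((m : ℝ) ^ (2 * γ) * a ^ 2 * (sobolevConst ⌈γ⌉₊ *
        ((∫ x, φ x ^ 2) + ∫ x, iteratedDeriv ⌈γ⌉₊ φ x ^ 2))) := by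
  set k := ⌈γ⌉₊
  have hm0 : (0 : ℝ) < m := by exact_mod_cast hm
  have hm1 : (1 : ℝ) ≤ m := by exact_mod_cast hm
  have hz : ∀ j x, x ∉ Set.Ioo (0 : ℝ) 1 → iteratedDeriv j φ x = 0 := fun j x hx =>
    image_eq_zero_of_notMem_tsupport fun h => hx (hsupp (tsupport_iteratedDeriv_subset φ j h))
  have hz0 : ∀ x, x ∉ Set.Ioo (0 : ℝ) 1 → φ x = 0 := by simpa using hz 0
  have hc : HasCompactSupport φ := HasCompactSupport.intro isCompact_Icc
    fun x hx => hz0 x fun h => hx (Set.Ioo_subset_Icc_self h)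
  have hWs : ContDiff ℝ (⊤ : ℕ∞) fun x => a * superposition s φ x :=
    contDiff_const.mul (contDiff_superposition hφ)
  have hWc : HasCompactSupport fun x => a * superposition s φ x :=
    (hasCompactSupport_superposition hz0).mul_left
  refine (lintegral_sobolev_le hWs hWc hγ (Nat.le_ceil γ) (inv_pos.2 hm0)
    (inv_le_one_of_one_le₀ hm1)).trans (le_of_eq ?_)
  have h1 : ∫ x, (a * superposition s φ x) ^ 2 = a ^ 2 * ∫ x, φ x ^ 2 := by
    simp_rw [mul_pow]
    rw [integral_const_mul, integral_superposition_sq hz0 (integrable_sq_of_contDiff hφ hc) hs hm]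
  have h2 : ∫ x, iteratedDeriv k (fun x => a * superposition s φ x) x ^ 2
      = (m : ℝ) ^ (2 * k) * a ^ 2 * ∫ x, iteratedDeriv k φ x ^ 2 := by
    have h3 : ∀ x, iteratedDeriv k (fun x => a * superposition s φ x) x ^ 2
        = (m : ℝ) ^ (2 * k) * a ^ 2 * superposition s (iteratedDeriv k φ) x ^ 2 := by
      intro x
      rw [iteratedDeriv_const_mul_field, iteratedDeriv_superposition hφ]
      ring
    simp_rw [h3]
    rw [integral_const_mul, integral_superposition_sq (hz k)
      (integrable_sq_of_contDiff (contDiff_iteratedDeriv hφ k) (hasCompactSupport_iteratedDeriv hc k))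
      hs hm]
  rw [h1, h2, Real.inv_rpow hm0.le, Real.rpow_neg hm0.le, inv_inv, inv_pow]
  congr 1
  field_simp
  simp only [k]
  ring

end Construction

/-! ### The lower bound -/

/-- The sign `±1` attached to a Boolean. -/
def boolSign (b : Bool) : ℝ := if b then 1 else -1

lemma boolSign_sq (b : Bool) : boolSign b ^ 2 = 1 := by cases b <;> norm_num [boolSign]

lemma abs_boolSign_le (b : Bool) : |boolSign b| ≤ 1 := by cases b <;> norm_num [boolSign]

lemma boolSign_not (b : Bool) : boolSign (!b) = -boolSign b := by cases b <;> norm_num [boolSign]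

lemma superposition_sub_flipAt {m : ℕ} (θ : Fin m → Bool) (k : Fin m) (φ : ℝ → ℝ) (x : ℝ) :
    superposition (fun j => boolSign (θ j)) φ x
      - superposition (fun j => boolSign (flipAt k θ j)) φ x
      = 2 * boolSign (θ k) * φ (m * x - (k : ℕ)) := by
  rw [superposition, superposition, ← Finset.sum_sub_distrib, Finset.sum_eq_single k]
  · simp only [flipAt, Function.update_self, boolSign_not]
    ring
  · intro j _ hj
    simp [flipAt, Function.update_of_ne hj]
  · simp

/-- Lower bound from a hypercube of `2 ^ m` densities with perturbations of height `a`. -/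
theorem le_minimaxRisk_of_perturbation {γ δ L : ℝ} (hγ : 0 < γ) (hδ : 0 ≤ δ) {φ f₀ : ℝ → ℝ}
    (hφ : ContDiff ℝ (⊤ : ℕ∞) φ) (hsupp : tsupport φ ⊆ Set.Ioo 0 1) (hφ0 : ∫ x, φ x = 0)
    (hφ1 : ∀ x, |φ x| ≤ 1) (hf₀ : IsDensity f₀) (hf₀c : Continuous f₀) {c : ℝ} (hc : 0 < c)
    (hlow : ∀ x ∈ Set.Icc (0 : ℝ) 1, 2 * c ≤ f₀ x)
    (hS : ∫⁻ t, ENNReal.ofReal ((1 + t ^ 2) ^ γ) * ‖fourierHat f₀ t‖ₑ ^ 2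
      ≤ ENNReal.ofReal (L ^ 2 / 4))
    {m n : ℕ} (hn : 1 ≤ n) (hm : 0 < m) {a : ℝ} (ha : 0 ≤ a) (hac : a ≤ c)
    (haS : (m : ℝ) ^ (2 * γ) * a ^ 2 * (sobolevConst ⌈γ⌉₊ *
        ((∫ x, φ x ^ 2) + ∫ x, iteratedDeriv ⌈γ⌉₊ φ x ^ 2)) ≤ L ^ 2 / 4)
    (hna : n * (4 * a ^ 2 * ((∫ x, φ x ^ 2) / m)) ≤ c) :
    ENNReal.ofReal (a ^ 2 * (∫ x, φ x ^ 2) / 4) ≤ minimaxRisk n (densityClass γ δ L) := by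
  have hm0 : (0 : ℝ) < m := by exact_mod_cast hm
  have hz0 : ∀ x, x ∉ Set.Ioo (0 : ℝ) 1 → φ x = 0 := fun x hx =>
    image_eq_zero_of_notMem_tsupport fun h => hx (hsupp h)
  have hcs : HasCompactSupport φ := HasCompactSupport.intro isCompact_Icc
    fun x hx => hz0 x fun h => hx (Set.Ioo_subset_Icc_self h)
  have hφi : Integrable φ := hφ.continuous.integrable_of_hasCompactSupport hcs
  have hφ2 := integrable_sq_of_contDiff hφ hcs
  let W : (Fin m → Bool) → ℝ → ℝ := fun θ => superposition (fun j => boolSign (θ j)) φ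
  have hWc : ∀ θ, Continuous (W θ) := fun θ => (contDiff_superposition hφ).continuous
  have hWi : ∀ θ, Integrable fun x => a * W θ x := fun θ =>
    ((hWc θ).integrable_of_hasCompactSupport (hasCompactSupport_superposition hz0)).const_mul a
  have hWb : ∀ θ x, |a * W θ x| ≤ a := fun θ x => by
    rw [abs_mul, abs_of_nonneg ha]
    exact mul_le_of_le_one_right ha
      (abs_superposition_le hz0 (fun k => abs_boolSign_le _) hφ1 x)
  -- On [0, 1] the base is at least 2c and the perturbation at most a ≤ c, so f ≥ c there; outside,
  -- nothing changes.
  let f : (Fin m → Bool) → ℝ → ℝ := fun θ x => f₀ x + a * W θ x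
  have hfc : ∀ θ, ∀ x ∈ Set.Icc (0 : ℝ) 1, c ≤ f θ x := fun θ x hx => by
    have h1 := hlow x hx
    have h2 := (abs_le.1 (hWb θ x)).1
    simp only [f]
    linarith
  have hfd : ∀ θ, IsDensity (f θ) := by
    intro θ
    refine ⟨fun x => ?_, hf₀.2.1.add (hWi θ), ?_⟩
    · by_cases hx : x ∈ Set.Icc (0 : ℝ) 1
      · exact hc.le.trans (hfc θ x hx)
      · simp only [f, W]
        rw [superposition_eq_zero hz0 hx, mul_zero, add_zero]
        exact hf₀.1 x
    · simp only [f]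
      rw [integral_add hf₀.2.1 (hWi θ), integral_const_mul]
      simp only [W]
      rw [integral_superposition hφi hφ0 hm, hf₀.2.2]
      ring
  have hmem : ∀ θ, f θ ∈ densityClass γ δ L := fun θ =>
    add_mem_densityClass hδ hf₀.2.1 (hWi θ) (hfd θ) hS
      ((lintegral_sobolev_superposition_le hγ hφ hsupp hm (fun k => boolSign_sq _) a).trans
        (ENNReal.ofReal_le_ofReal haS))
  have hdiff : ∀ θ k x, f θ x - f (flipAt k θ) x
      = a * (2 * boolSign (θ k) * φ (m * x - (k : ℕ))) := fun θ k x => by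
    rw [← superposition_sub_flipAt]
    simp only [f, W]
    ring
  have hdsq : ∀ θ k x, (f θ x - f (flipAt k θ) x) ^ 2
      = 4 * a ^ 2 * (fun y => φ y ^ 2) (m * x - (k : ℕ)) := fun θ k x => by
    rw [hdiff]
    linear_combination 4 * a ^ 2 * φ (m * x - (k : ℕ)) ^ 2 * boolSign_sq (θ k)
  have hdint : ∀ (θ : Fin m → Bool) (k : Fin m), Integrable fun x => (f θ x - f (flipAt k θ) x) ^ 2 :=
    fun θ k => by
      simp_rw [hdsq]
      exact (integrable_comp_affine hφ2 hm _).const_mul _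
  have hdval : ∀ (θ : Fin m → Bool) (k : Fin m), ∫ x, (f θ x - f (flipAt k θ) x) ^ 2
      = 4 * a ^ 2 * ((∫ x, φ x ^ 2) / m) := fun θ k => by
    simp_rw [hdsq]
    rw [integral_const_mul, integral_comp_affine (fun y => φ y ^ 2) hm]
  have hI0 : 0 ≤ ∫ x, φ x ^ 2 := integral_nonneg fun x => sq_nonneg _
  let I : Fin m → Set ℝ := fun k => {x | (m : ℝ) * x - ((k : ℕ) : ℝ) ∈ Set.Ioo (0 : ℝ) 1}
  have hI : ∀ k, MeasurableSet (I k) := fun k =>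
    (by fun_prop : Measurable fun x : ℝ => (m : ℝ) * x - ((k : ℕ) : ℝ)) measurableSet_Ioo
  have hdisj : Pairwise (Function.onFun Disjoint I) := by
    intro j k hjk
    rw [Function.onFun, Set.disjoint_left]
    intro x hj hk
    -- The separation lemma is applied to the indicator of the unit interval to get disjointness of
    -- the blocks.
    have h1 := eq_zero_or_eq_zero (m := m) (ψ := (Set.Ioo (0 : ℝ) 1).indicator 1)
      (fun y hy => Set.indicator_of_notMem hy _) hjk x
    have hj' : (m : ℝ) * x - ((j : ℕ) : ℝ) ∈ Set.Ioo (0 : ℝ) 1 := hj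
    have hk' : (m : ℝ) * x - ((k : ℕ) : ℝ) ∈ Set.Ioo (0 : ℝ) 1 := hk
    rw [Set.indicator_of_mem hj', Set.indicator_of_mem hk'] at h1
    simp at h1
  have hsep : ∀ (θ : Fin m → Bool) (k : Fin m), ENNReal.ofReal (4 * a ^ 2 * ((∫ x, φ x ^ 2) / m))
      ≤ ∫⁻ x in I k, ‖f θ x - f (flipAt k θ) x‖ₑ ^ 2 := by
    intro θ k
    rw [setLIntegral_eq_of_support_subset]
    · rw [← hdval θ k, ofReal_integral_eq_lintegral_ofReal (hdint θ k) (ae_of_all _ fun x => sq_nonneg _)]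
      refine lintegral_mono fun x => le_of_eq ?_
      rw [← ofReal_norm, ← ENNReal.ofReal_pow (norm_nonneg _), Real.norm_eq_abs, sq_abs]
    · intro x hx
      by_contra h
      apply hx
      simp only [hdiff]
      rw [hz0 _ h]
      simp
  have hmain := le_minimaxRisk_of_hypercube hn f hmem hfd
    (fun θ => (hf₀c.add (continuous_const.mul (hWc θ))).measurable) hc ?_ hdint
    (fun θ k => by rw [hdval]; exact hna) I hI hdisj (by positivity) hsep
  · convert hmain using 2
    field_simp
    norm_num
  -- Vertices that differ in sign k agree off block k; on it both densities are at least c.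
  · intro θ k x
    by_cases hx : x ∈ I k
    · right
      have h1 := mem_Icc_of_mem_Ioo k hx
      linarith [hfc θ x h1, hfc (flipAt k θ) x h1]
    · left
      rw [← sub_eq_zero, hdiff, hz0 _ hx]
      ring

theorem exists_le_minimaxRisk {γ L : ℝ} (hγ : 0 < γ) (hL : 0 < L) :
    ∃ c : ℝ, 0 < c ∧ ∀ δ : ℝ, 1 < δ → ∀ n : ℕ, 1 ≤ n →
      ENNReal.ofReal (c * rate n γ ^ 2) ≤ minimaxRisk n (densityClass γ δ L) := by
  obtain ⟨φ, hφ, hsupp, hφ0, hφpos, hφ1⟩ := exists_wavelet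
  obtain ⟨f₀, hf₀, hf₀s, -, ⟨c₀, hc₀, hlow⟩, hS⟩ :=
    exists_base_density (γ := γ) (ε := L ^ 2 / 4) hγ (by positivity)
  set J := ∫ x, φ x ^ 2 with hJ
  have hJ' : 0 ≤ ∫ x, iteratedDeriv ⌈γ⌉₊ φ x ^ 2 := integral_nonneg fun x => sq_nonneg _
  set Q := sobolevConst ⌈γ⌉₊ * (J + ∫ x, iteratedDeriv ⌈γ⌉₊ φ x ^ 2) with hQ
  have hQ0 : 0 ≤ Q := mul_nonneg (sobolevConst_pos _).le (by positivity)
  set c := c₀ / 2 with hc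
  have hc0 : 0 < c := by positivity
  -- The three constraints on the amplitude: positivity of the densities, membership in the class,
  -- indistinguishability from n observations. Imposing b ≤ 1 gives b² ≤ b, which makes the last two
  -- linear.
  obtain ⟨b, hb0, hbc, hbQ, hbJ⟩ : ∃ b : ℝ, 0 < b ∧ b ≤ c ∧ b ^ 2 * Q ≤ L ^ 2 / 4 ∧
      4 * b ^ 2 * J ≤ c := by
    set q := min (L ^ 2 / 4) c
    have hq : 0 < q := by positivity
    refine ⟨min c (min 1 (q / (Q + 4 * J))), by positivity, min_le_left _ _, ?_⟩
    set b := min c (min 1 (q / (Q + 4 * J)))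
    have hb : 0 < b := by positivity
    have hb1 : b ≤ 1 := (min_le_right _ _).trans (min_le_left _ _)
    have hbq : b ≤ q / (Q + 4 * J) := (min_le_right _ _).trans (min_le_right _ _)
    rw [le_div_iff₀ (by positivity)] at hbq
    have hb2 : b ^ 2 ≤ b := by nlinarith
    have h1 : b ^ 2 * (Q + 4 * J) ≤ q := le_trans (by gcongr) hbq
    have h2 : 0 ≤ b ^ 2 * Q := by positivity
    have h3 : 0 ≤ b ^ 2 * (4 * J) := by positivity
    constructor
    · linarith [min_le_left (L ^ 2 / 4) c]
    · linarith [min_le_right (L ^ 2 / 4) c]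
  -- The factor 2^(-2γ) pays for rounding n^(1/(2γ+1)) up to an integer m, which at most doubles it.
  refine ⟨b ^ 2 * J / 4 * 2 ^ (-(2 * γ)), by positivity, fun δ hδ n hn => ?_⟩
  have hn1 : (1 : ℝ) ≤ n := by exact_mod_cast hn
  have hn0 : (0 : ℝ) < n := by linarith
  set u := (n : ℝ) ^ (1 / (2 * γ + 1)) with hu
  have hu1 : 1 ≤ u := Real.one_le_rpow hn1 (by positivity)
  set m := ⌈u⌉₊ with hm
  have hum : u ≤ m := Nat.le_ceil u
  have hmu : (m : ℝ) ≤ 2 * u := by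
    have := Nat.ceil_lt_add_one (a := u) (by linarith)
    linarith
  have hm1 : (1 : ℝ) ≤ m := hu1.trans hum
  have hm0 : (0 : ℝ) < m := by linarith
  have hmpos : 0 < m := by exact_mod_cast hm0
  set a := b * (m : ℝ) ^ (-γ) with ha
  have ha0 : 0 ≤ a := by positivity
  have hasq : a ^ 2 = b ^ 2 * (m : ℝ) ^ (-(2 * γ)) := by
    rw [ha, mul_pow, ← Real.rpow_mul_natCast hm0.le]
    congr 2
    push_cast
    ring
  have hmm : (m : ℝ) ^ (2 * γ) * a ^ 2 = b ^ 2 := by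
    rw [hasq, mul_left_comm, ← Real.rpow_add hm0, add_neg_cancel, Real.rpow_zero, mul_one]
  have hac : a ≤ c := le_trans (mul_le_of_le_one_right hb0.le
    (Real.rpow_le_one_of_one_le_of_nonpos hm1 (by linarith))) hbc
  have hnm : (n : ℝ) ≤ (m : ℝ) ^ (2 * γ) * m := by
    calc (n : ℝ) = u ^ (2 * γ + 1) := by
          rw [hu, ← Real.rpow_mul hn0.le, one_div, inv_mul_cancel₀ (by positivity), Real.rpow_one]
      _ ≤ (m : ℝ) ^ (2 * γ + 1) := Real.rpow_le_rpow (by linarith) hum (by positivity)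
      _ = _ := by rw [Real.rpow_add hm0, Real.rpow_one]
  have hna : n * (4 * a ^ 2 * (J / m)) ≤ c := by
    calc n * (4 * a ^ 2 * (J / m)) ≤ ((m : ℝ) ^ (2 * γ) * m) * (4 * a ^ 2 * (J / m)) := by gcongr
      _ = 4 * ((m : ℝ) ^ (2 * γ) * a ^ 2) * J := by field_simp
      _ ≤ c := by rw [hmm]; exact hbJ
  refine le_trans (ENNReal.ofReal_le_ofReal ?_) (le_minimaxRisk_of_perturbation hγ (by linarith) hφ
    hsupp hφ0 hφ1 hf₀ hf₀s.continuous hc0 (fun x hx => by rw [hc]; linarith [hlow x hx]) hS hn hmpos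
    ha0 hac (by rw [hmm]; exact hbQ) hna)
  have hrate : rate n γ ^ 2 = u ^ (-(2 * γ)) := by
    rw [rate, hu, ← Real.rpow_mul_natCast hn0.le, ← Real.rpow_mul hn0.le]
    congr 1
    push_cast
    ring
  have hdec : 2 ^ (-(2 * γ)) * u ^ (-(2 * γ)) ≤ (m : ℝ) ^ (-(2 * γ)) := by
    rw [← Real.mul_rpow (by norm_num) (by linarith)]
    exact Real.rpow_le_rpow_of_nonpos hm0 hmu (by linarith)
  rw [hrate, hasq]
  calc _ = b ^ 2 * J / 4 * (2 ^ (-(2 * γ)) * u ^ (-(2 * γ))) := by ring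
    _ ≤ b ^ 2 * J / 4 * (m : ℝ) ^ (-(2 * γ)) := by gcongr
    _ = _ := by ring

end LogSobolev

theorem proposition2 (γ L : ℝ) (hγ : 0 < γ) (hL : 0 < L) :
    (∃ c : ℝ, 0 < c ∧ ∀ δ : ℝ, 1 < δ → ∀ n : ℕ, 1 ≤ n →
      ENNReal.ofReal (c * LogSobolev.rate n γ ^ 2)
        ≤ LogSobolev.minimaxRisk n (LogSobolev.densityClass γ δ L)) ∧
    (∀ δ : ℝ, 1 < δ → ∃ C : ℝ, 0 < C ∧ ∀ n : ℕ, 2 ≤ n →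
      LogSobolev.minimaxRisk n (LogSobolev.densityClass γ δ L)
        ≤ ENNReal.ofReal
            (C * (LogSobolev.rate n γ ^ 2 * Real.log n ^ (δ / (2 * γ + 1))))) :=
  ⟨LogSobolev.exists_le_minimaxRisk hγ hL,
    fun _ hδ => LogSobolev.exists_minimaxRisk_le L hγ hδ⟩
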